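/- Let $L=(L_t)_{t\in\mathbb R}$ be a two-sided Lévy process on a probability space $(\Omega,\mathcal F,\mathbb P)$, that is, $L_t=L^{(1)}_t$ for $t\ge 0$ and $L_t=-L^{(2)}_{(-t)-}$ for $t<0$, where $L^{(1)}$ and $L^{(2)}$ are independent copies of a real-valued Lévy process. Assume that $L$ has no Gaussian component, $\mathbb E(L_1)=0$ and $\mathbb E(L_1^2)<\infty$. Let $f:\mathbb R^2\to\mathbb R$ be a measurable function such that $f(t,\cdot)\in L^2(\mathbb R)$ for every $t\in\mathbb R$, and let $S=(S_t)_{t\in\mathbb R}$, $$S_t=\int_{\mathbb R} f(t,u)\,L(\mathrm du),\qquad t\in\mathbb R,$$ be the corresponding generalized fractional Lévy process. Here the integral is understood in the $L^2(\Omega)$-sense: it is the $L^2(\Omega)$-limit of the elementary integrals $\sum_i c_i(L_{b_i}-L_{a_i})$ of step functions $\sum_i c_i\mathbf 1_{(a_i,b_i]}$ converging to $f(t,\cdot)$ in $L^2(\mathbb R)$. For $\alpha,\delta\in\mathbb R$, a process $(X_t)_{t\in\mathbb R}$ is called $(\alpha,\delta)$-dilatively stable if all its finite-dimensional distributions are infinitely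 divisible and $$\psi_{Tt_1,\dots,Tt_k}(\theta_1,\dots,\theta_k)=T^{\delta}\,\psi_{t_1,\dots,t_k}\bigl(T^{\alpha-\frac{\delta}{2}}\theta_1,\dots,T^{\alpha-\frac{\delta}{2}}\theta_k\bigr)$$ for all $T>0$, $k\in\mathbb N$, $t_1,\dots,t_k\in\mathbb R$ and $\theta_1,\dots,\theta_k\in\mathbb R$, where $\psi_{t_1,\dots,t_k}$ is the characteristic exponent of $(X_{t_1},\dots,X_{t_k})$, i.e. the unique continuous function with $\psi_{t_1,\dots,t_k}(0)=0$ and $\mathbb E\bigl(e^{i\sum_j\theta_jX_{t_j}}\bigr)=e^{-\psi_{t_1,\dots,t_k}(\theta_1,\dots,\theta_k)}$. Let $\alpha,\delta\in\mathbb R$ and suppose that $$f(t,u)=T^{\alpha-\frac{\delta}{2}}\,f\Bigl(\frac tT,\frac u{T^{\delta}}\Bigr)\qquad\text{for all } t,u\in\mathbb R,\ T>0.$$ Then $S$ is $(\alpha,\delta)$-dilatively stable. If, in addition, $\mathbb E(L_1^2)>0$ and $\int_{\mathbb R} f(1,u)^2\,\mathrm du>0$, then the parameters are uniquely determined: if $S$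 is also $(\alpha',\delta')$-dilatively stable for some $\alpha',\delta'\in\mathbb R$, then $\alpha'=\alpha$ and $\delta'=\delta$. -/

import Mathlib

open MeasureTheory ProbabilityTheory Filter Topology
open scoped NNReal ENNReal

/-! ### Infinitely divisible laws and processes, characteristic exponents -/

/-- A finite-dimensional law `ν` is infinitely divisible if for every `n ≥ 1` it is the law of the
sum of `n` independent random vectors with a common law `ρ`. -/
def IsInfinitelyDivisible {k : ℕ} (ν : Measure (Fin k → ℝ)) : Prop :=
  ∀ n : ℕ, 0 < n → ∃ ρ : Measure (Fin k → ℝ), IsProbabilityMeasure ρ ∧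
    ν = (Measure.pi fun _ : Fin n => ρ).map (fun x => ∑ i, x i)

/-- The law of `(X_{t_1}, …, X_{t_k})`. -/
noncomputable def fdd {Ω : Type*} [MeasurableSpace Ω] (P : Measure Ω) (X : ℝ → Ω → ℝ)
    {k : ℕ} (t : Fin k → ℝ) : Measure (Fin k → ℝ) :=
  P.map (fun ω j => X (t j) ω)

/-- A process is infinitely divisible if all its finite-dimensional laws are. -/
def IsInfinitelyDivisibleProcess {Ω : Type*} [MeasurableSpace Ω] (P : Measure Ω)
    (X : ℝ → Ω → ℝ) : Prop :=
  (∀ t, AEMeasurable (X t) P) ∧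
    ∀ (k : ℕ) (t : Fin k → ℝ), IsInfinitelyDivisible (fdd P X t)

/-- `ψ` is the characteristic exponent of the law `ν`: it is continuous, vanishes at `0`, and the
characteristic function of `ν` is `exp (-ψ)`. -/
structure IsCharacteristicExponent {k : ℕ} (ν : Measure (Fin k → ℝ))
    (ψ : (Fin k → ℝ) → ℂ) : Prop where
  continuous : Continuous ψ
  map_zero : ψ 0 = 0
  exp_neg : ∀ θ : Fin k → ℝ,
    ∫ x, Complex.exp (Complex.I * ((∑ j, θ j * x j : ℝ) : ℂ)) ∂ν = Complex.exp (-ψ θ)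

/-- The characteristic exponent is unique. -/
theorem IsCharacteristicExponent.unique {k : ℕ} {ν : Measure (Fin k → ℝ)}
    {ψ₁ ψ₂ : (Fin k → ℝ) → ℂ} (h₁ : IsCharacteristicExponent ν ψ₁)
    (h₂ : IsCharacteristicExponent ν ψ₂) : ψ₁ = ψ₂ := by
  have key : ∀ θ, ∃ n : ℤ, -ψ₁ θ = -ψ₂ θ + n * (2 * Real.pi * Complex.I) := fun θ =>
    Complex.exp_eq_exp_iff_exists_int.1 ((h₁.exp_neg θ).symm.trans (h₂.exp_neg θ))
  choose N hN using key
  have hre : ∀ θ, (N θ : ℝ) = (ψ₂ θ - ψ₁ θ).im / (2 * Real.pi) := by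
    intro θ
    have h : ψ₂ θ - ψ₁ θ = N θ * (2 * Real.pi * Complex.I) := by linear_combination hN θ
    rw [h, eq_div_iff (by positivity)]
    simp
  have hcr : Continuous fun θ => (N θ : ℝ) := by
    simp_rw [hre]
    exact (Complex.continuous_im.comp (h₂.continuous.sub h₁.continuous)).div_const _
  have hc : Continuous N := Int.isClosedEmbedding_coe_real.isInducing.continuous_iff.2 hcr
  have h0 : N 0 = 0 := by
    have := hre 0
    rw [h₁.map_zero, h₂.map_zero] at this
    simpa using this
  funext θ
  have hθ : N θ = 0 := (PreconnectedSpace.constant inferInstance hc).trans h0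
  have := hN θ
  rw [hθ] at this
  linear_combination -this

/-- `(α, δ)`-dilative stability of a process indexed by `ℝ`: the process is infinitely divisible
and the characteristic exponents `ψ_{t_1,…,t_k}` of its finite-dimensional laws satisfy
`ψ_{T t_1,…,T t_k}(θ) = T^δ ψ_{t_1,…,t_k}(T^{α - δ/2} θ)`. -/
def IsDilativelyStable {Ω : Type*} [MeasurableSpace Ω] (P : Measure Ω)
    (X : ℝ → Ω → ℝ) (α δ : ℝ) : Prop :=
  IsInfinitelyDivisibleProcess P X ∧
    ∃ ψ : ∀ {k : ℕ}, (Fin k → ℝ) → (Fin k → ℝ) → ℂ,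
      (∀ (k : ℕ) (t : Fin k → ℝ), IsCharacteristicExponent (fdd P X t) (ψ t)) ∧
      ∀ T : ℝ, 0 < T → ∀ (k : ℕ) (t θ : Fin k → ℝ),
        ψ (fun j => T * t j) θ
          = ((T ^ δ : ℝ) : ℂ) * ψ t (fun j => T ^ (α - δ / 2) * θ j)

/-! ### Lévy processes -/

/-- A real-valued Lévy process indexed by `[0, ∞)`. -/
structure IsLevyProcess {Ω : Type*} [MeasurableSpace Ω] (P : Measure Ω)
    (L : ℝ≥0 → Ω → ℝ) : Prop where
  measurable : ∀ t, Measurable (L t)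
  zero : ∀ᵐ ω ∂P, L 0 ω = 0
  indep : HasIndepIncrements L P
  stationary : ∀ s h : ℝ≥0, IdentDistrib (fun ω => L (s + h) ω - L s ω) (L h) P P
  stochCont : ∀ t, TendstoInMeasure P L (𝓝 t) (L t)
  cadlag : ∀ᵐ ω ∂P, ∀ t : ℝ≥0, ContinuousWithinAt (fun s => L s ω) (Set.Ici t) t ∧
    ∃ l : ℝ, Tendsto (fun s => L s ω) (𝓝[<] t) (𝓝 l)

/-- The two-sided process equal to `L¹_t` for `t ≥ 0` and to `-L²_{(-t)-}` (a left limit) for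
`t < 0`. -/
noncomputable def twoSided {Ω : Type*} (L₁ L₂ : ℝ≥0 → Ω → ℝ) (t : ℝ) (ω : Ω) : ℝ :=
  if 0 ≤ t then L₁ t.toNNReal ω else -Function.leftLim (fun s => L₂ s ω) (-t).toNNReal

/-- A two-sided Lévy process is built from two independent copies of a Lévy process. -/
def IsTwoSidedLevyProcess {Ω : Type*} [MeasurableSpace Ω] (P : Measure Ω)
    (L : ℝ → Ω → ℝ) : Prop :=
  ∃ L₁ L₂ : ℝ≥0 → Ω → ℝ, IsLevyProcess P L₁ ∧ IsLevyProcess P L₂ ∧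
    IdentDistrib (fun ω s => L₁ s ω) (fun ω s => L₂ s ω) P P ∧
    IndepFun (fun ω s => L₁ s ω) (fun ω s => L₂ s ω) P ∧
    L = twoSided L₁ L₂

/-- A Lévy measure on the real line. -/
def IsLevyMeasure (μ : Measure ℝ) : Prop :=
  μ {0} = 0 ∧ ∫⁻ x, ENNReal.ofReal (min 1 (x ^ 2)) ∂μ < ∞

/-- The law `ν` on `ℝ` has Lévy–Khintchine triplet `(b, v, μ)`: drift `b`, Gaussian variance `v`
and Lévy measure `μ`, with respect to the truncation function `x / (1 + x²)`. -/
def HasLevyTriplet (ν : Measure ℝ) (b : ℝ) (v : ℝ≥0) (μ : Measure ℝ) : Prop :=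
  IsLevyMeasure μ ∧ ∀ θ : ℝ,
    ∫ x, Complex.exp (Complex.I * ((θ * x : ℝ) : ℂ)) ∂ν
      = Complex.exp (Complex.I * ((b * θ : ℝ) : ℂ) - (((v : ℝ) * θ ^ 2 / 2 : ℝ) : ℂ)
          + ∫ x, (Complex.exp (Complex.I * ((θ * x : ℝ) : ℂ)) - 1
              - Complex.I * ((θ * x / (1 + x ^ 2) : ℝ) : ℂ)) ∂μ)

/-- An infinitely divisible law on `ℝ` without Gaussian component. -/
def HasNoGaussianComponent (ν : Measure ℝ) : Prop :=
  ∃ (b : ℝ) (μ : Measure ℝ), HasLevyTriplet ν b 0 μ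

/-! ### Integration of deterministic functions with respect to a two-sided process -/

/-- Step functions `∑ i, c i • 1_{(a i, b i]}` on the real line. -/
structure StepFun where
  n : ℕ
  c : Fin n → ℝ
  a : Fin n → ℝ
  b : Fin n → ℝ
  le : ∀ i, a i ≤ b i

/-- The function represented by a step function. -/
noncomputable def StepFun.toFun (h : StepFun) (u : ℝ) : ℝ :=
  ∑ i, (Set.Ioc (h.a i) (h.b i)).indicator (fun _ => h.c i) u

/-- The elementary integral `∑ i, c i (L_{b i} - L_{a i})` of a step function. -/
noncomputable def StepFun.integral {Ω : Type*} (h : StepFun) (L : ℝ → Ω → ℝ) (ω : Ω) : ℝ :=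
  ∑ i, h.c i * (L (h.b i) ω - L (h.a i) ω)

/-- `Y = ∫ g(u) L(du)` in the `L²(Ω)` sense: `Y` is the `L²(Ω)`-limit of the elementary integrals
of some step functions that converge to `g` in `L²(ℝ)`. -/
def IsLevyIntegral {Ω : Type*} [MeasurableSpace Ω] (P : Measure Ω) (L : ℝ → Ω → ℝ)
    (g : ℝ → ℝ) (Y : Ω → ℝ) : Prop :=
  MemLp Y 2 P ∧ ∃ h : ℕ → StepFun,
    Tendsto (fun n => eLpNorm (fun u => (h n).toFun u - g u) 2 volume) atTop (𝓝 0) ∧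
    Tendsto (fun n => eLpNorm (fun ω => (h n).integral L ω - Y ω) 2 P) atTop (𝓝 0)

/-- `S` is a generalized fractional Lévy process with kernel `f`, driven by `L`: here `L` is a
two-sided Lévy process without Gaussian component, centered and square integrable, `f` is
measurable with `f(t, ·) ∈ L²(ℝ)` for every `t`, and `S_t = ∫ f(t, u) L(du)`. -/
structure IsGenFracLevyProcess {Ω : Type*} [MeasurableSpace Ω] (P : Measure Ω)
    (L : ℝ → Ω → ℝ) (f : ℝ → ℝ → ℝ) (S : ℝ → Ω → ℝ) : Prop where
  levy : IsTwoSidedLevyProcess P L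
  noGaussian : HasNoGaussianComponent (P.map (L 1))
  memLp : MemLp (L 1) 2 P
  centered : ∫ ω, L 1 ω ∂P = 0
  kernel_measurable : Measurable fun p : ℝ × ℝ => f p.1 p.2
  kernel_memLp : ∀ t, MemLp (f t) 2 volume
  eq_integral : ∀ t, IsLevyIntegral P L (f t) (S t)

/-! Let `ψ` be the characteristic exponent of `L 1`. Everything rests on the formula that `(S_{t_1},
…, S_{t_k})` has exponent `θ ↦ ∫ ψ (∑ θ_j f(t_j, u)) du`. For step kernels it comes from independent
stationary increments. The general case follows because `g ↦ ∫ ψ (g u) du` is continuous on `L²`,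
thanks to a global bound `‖ψ θ‖ ≤ C θ²` (`IsPureJumpExponent.tendsto_integral_comp`,
`IsLevyIntegral.piCharFun_map`).

Given the formula, dilative stability is the substitution `u = T^δ w` (`integral_comp_sum_scaling`).
For infinite divisibility, compressing step functions by a factor `m` divides the exponent by `m`,
and Lévy's continuity theorem turns the limits into convolution roots.

For uniqueness, put `q r = ∫ ψ (r f(1, u)) du`. Finite variance gives `q r / r² → (E L_1² / 2) ∫
f(1, ·)² ≠ 0` as `r → 0`; absence of a Gaussian part gives `q r / r² → 0` as `r → ∞`. Comparing the
two scalings of `q` near `0` forces `α' = α`. If `δ' ≠ δ`, then `q r / r²` would be constant on `(0,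
∞)`, against its two distinct limits (`scaling_exponents_unique`). -/

/-! ### Estimates for the Lévy–Khintchine kernel -/

/-- The compensated kernel of the Lévy–Khintchine formula. -/
noncomputable def levyKernel (θ x : ℝ) : ℂ :=
  Complex.exp (Complex.I * ((θ * x : ℝ) : ℂ)) - 1 - Complex.I * ((θ * x / (1 + x ^ 2) : ℝ) : ℂ)

lemma continuous_levyKernel : Continuous fun p : ℝ × ℝ => levyKernel p.1 p.2 := by
  unfold levyKernel
  have h : ∀ p : ℝ × ℝ, 1 + p.2 ^ 2 ≠ 0 := fun p => by positivity
  fun_prop (disch := exact h _)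

lemma norm_exp_I_mul_sub_one_sub_le (y : ℝ) :
    ‖Complex.exp (Complex.I * (y : ℂ)) - 1 - Complex.I * (y : ℂ)‖ ≤ 2 * y ^ 2 := by
  have hn : ‖Complex.I * (y : ℂ)‖ = |y| := by simp
  rcases le_total |y| 1 with h | h
  · have := Complex.norm_exp_sub_one_sub_id_le (x := Complex.I * (y : ℂ)) (by rwa [hn])
    rw [hn, sq_abs] at this
    nlinarith [sq_nonneg y]
  · have h1 : ‖Complex.exp (Complex.I * (y : ℂ)) - 1‖ ≤ |y| :=
      Real.norm_exp_I_mul_ofReal_sub_one_le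
    calc _ ≤ ‖Complex.exp (Complex.I * (y : ℂ)) - 1‖ + ‖Complex.I * (y : ℂ)‖ := norm_sub_le _ _
      _ ≤ |y| + |y| := by rw [hn]; gcongr
      _ ≤ 2 * y ^ 2 := by rw [← sq_abs]; nlinarith

lemma norm_exp_I_mul_ofReal_sub_one_le_two (y : ℝ) :
    ‖Complex.exp (Complex.I * (y : ℂ)) - 1‖ ≤ 2 := by
  refine (norm_sub_le _ _).trans ?_
  rw [mul_comm, Complex.norm_exp_ofReal_mul_I, norm_one]
  norm_num

lemma norm_levyKernel_le_linear (θ x : ℝ) : ‖levyKernel θ x‖ ≤ 2 + |θ| := by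
  have h2 : ‖Complex.I * ((θ * x / (1 + x ^ 2) : ℝ) : ℂ)‖ ≤ |θ| := by
    rw [norm_mul, Complex.norm_I, one_mul, Complex.norm_real, Real.norm_eq_abs, abs_div, abs_mul,
      abs_of_pos (by positivity : 0 < 1 + x ^ 2), div_le_iff₀ (by positivity)]
    have : |x| ≤ 1 + x ^ 2 := by rw [← sq_abs]; nlinarith [sq_nonneg (|x| - 1), abs_nonneg x]
    exact mul_le_mul_of_nonneg_left this (abs_nonneg _)
  exact (norm_sub_le _ _).trans (add_le_add (norm_exp_I_mul_ofReal_sub_one_le_two _) h2)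

/-- For `|x| ≤ 1`, replacing the compensator `θ x / (1 + x²)` by `θ x` costs only `|θ| x²`, and the
rest is a second order Taylor remainder. The bound is integrable for any Lévy measure, and its
quadratic growth in `θ` still permits domination after division by `θ²`. -/
lemma norm_levyKernel_le (θ x : ℝ) : ‖levyKernel θ x‖ ≤ (3 + 3 * θ ^ 2) * min 1 (x ^ 2) := by
  have hθ : |θ| ≤ 1 + θ ^ 2 := by rw [← sq_abs]; nlinarith [sq_nonneg (|θ| - 1), abs_nonneg θ]
  rcases le_total |x| 1 with h | h
  · have hx : x ^ 2 ≤ 1 := by rw [← sq_abs]; nlinarith [abs_nonneg x]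
    rw [min_eq_right hx]
    have e : levyKernel θ x = (Complex.exp (Complex.I * ((θ * x : ℝ) : ℂ)) - 1
        - Complex.I * ((θ * x : ℝ) : ℂ)) + Complex.I * ((θ * x * (x ^ 2 / (1 + x ^ 2)) : ℝ) : ℂ) := by
      have : θ * x / (1 + x ^ 2) = θ * x - θ * x * (x ^ 2 / (1 + x ^ 2)) := by
        field_simp; ring
      rw [levyKernel, this]; push_cast; ring
    have h2 : ‖Complex.I * ((θ * x * (x ^ 2 / (1 + x ^ 2)) : ℝ) : ℂ)‖ ≤ |θ| * x ^ 2 := by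
      rw [norm_mul, Complex.norm_I, one_mul, Complex.norm_real, Real.norm_eq_abs, abs_mul, abs_mul,
        abs_of_nonneg (by positivity : 0 ≤ x ^ 2 / (1 + x ^ 2)), mul_assoc]
      refine mul_le_mul_of_nonneg_left ?_ (abs_nonneg _)
      have : x ^ 2 / (1 + x ^ 2) ≤ x ^ 2 := div_le_self (by positivity) (by nlinarith [sq_nonneg x])
      have h0 : 0 ≤ x ^ 2 / (1 + x ^ 2) := by positivity
      nlinarith
    rw [e]
    refine (norm_add_le _ _).trans ((add_le_add (norm_exp_I_mul_sub_one_sub_le _) h2).trans ?_)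
    nlinarith [sq_nonneg x]
  · have hx : 1 ≤ x ^ 2 := by rw [← sq_abs]; nlinarith [abs_nonneg x]
    rw [min_eq_left hx]
    have := norm_levyKernel_le_linear θ x
    nlinarith [sq_nonneg θ]

lemma IsLevyMeasure.integrable_min {μ : Measure ℝ} (hμ : IsLevyMeasure μ) :
    Integrable (fun x : ℝ => min 1 (x ^ 2)) μ := by
  have hc : Continuous fun x : ℝ => min 1 (x ^ 2) := by fun_prop
  refine ⟨hc.aestronglyMeasurable, ?_⟩
  rw [hasFiniteIntegral_iff_ofReal (ae_of_all _ fun x => by positivity)]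
  exact hμ.2

lemma IsLevyMeasure.continuous_integral_levyKernel {μ : Measure ℝ} (hμ : IsLevyMeasure μ) :
    Continuous fun θ => ∫ x, levyKernel θ x ∂μ := by
  refine continuous_iff_continuousAt.2 fun θ₀ => ?_
  refine continuousAt_of_dominated (bound := fun x => (3 + 3 * (|θ₀| + 1) ^ 2) * min 1 (x ^ 2))
    (Eventually.of_forall fun θ => ?_) ?_ (hμ.integrable_min.const_mul _) (ae_of_all _ fun x => ?_)
  · exact (continuous_levyKernel.comp (Continuous.prodMk_right θ)).aestronglyMeasurable
  · filter_upwards [Metric.ball_mem_nhds θ₀ one_pos] with θ hθ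
    refine ae_of_all _ fun x => (norm_levyKernel_le θ x).trans ?_
    have h1 : |θ| ≤ |θ₀| + 1 := by
      have := abs_sub_abs_le_abs_sub θ θ₀
      rw [Metric.mem_ball, Real.dist_eq] at hθ
      linarith
    have : θ ^ 2 ≤ (|θ₀| + 1) ^ 2 := by rw [← sq_abs]; gcongr
    gcongr
  · exact (continuous_levyKernel.comp (Continuous.prodMk_left x)).continuousAt

lemma tendsto_const_add_mul_div_sq_cobounded (a b : ℝ) :
    Tendsto (fun θ : ℝ => (a + b * |θ|) / θ ^ 2) (Bornology.cobounded ℝ) (𝓝 0) := by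
  have h : Tendsto (fun θ : ℝ => |θ|⁻¹) (Bornology.cobounded ℝ) (𝓝 0) :=
    tendsto_inv_atTop_zero.comp (tendsto_norm_cobounded_atTop (E := ℝ))
  have h2 : Tendsto (fun θ : ℝ => a * |θ|⁻¹ ^ 2 + b * |θ|⁻¹) (Bornology.cobounded ℝ) (𝓝 0) := by
    simpa using ((h.pow 2).const_mul a).add (h.const_mul b)
  refine h2.congr fun θ => ?_
  rcases eq_or_ne θ 0 with rfl | hθ
  · simp
  · have := abs_pos.2 hθ
    rw [← sq_abs θ]
    field_simp

/-- For fixed `x` the kernel grows at most linearly in `θ`, so the quotient tends to `0` pointwise.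
For `|θ| ≥ 1` it is dominated by `6 min(1, x²)`. Thus jumps never produce a quadratic term at
infinity; only a Gaussian part could. -/
lemma IsLevyMeasure.tendsto_integral_levyKernel_div_sq {μ : Measure ℝ} (hμ : IsLevyMeasure μ) :
    Tendsto (fun θ : ℝ => (∫ x, levyKernel θ x ∂μ) / (θ : ℂ) ^ 2) (Bornology.cobounded ℝ)
      (𝓝 0) := by
  have : (Bornology.cobounded ℝ).IsCountablyGenerated := by
    rw [IsOrderBornology.cobounded_eq]; infer_instance
  have key : Tendsto (fun θ : ℝ => ∫ x, levyKernel θ x / (θ : ℂ) ^ 2 ∂μ) (Bornology.cobounded ℝ)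
      (𝓝 (∫ _, (0 : ℂ) ∂μ)) := by
    refine tendsto_integral_filter_of_dominated_convergence (fun x => 6 * min 1 (x ^ 2))
      (Eventually.of_forall fun θ => ?_) ?_ (hμ.integrable_min.const_mul _)
      (ae_of_all _ fun x => ?_)
    · exact ((continuous_levyKernel.comp (Continuous.prodMk_right θ)).div_const _).aestronglyMeasurable
    · filter_upwards [(tendsto_norm_cobounded_atTop (E := ℝ)).eventually_ge_atTop 1] with θ hθ
      refine ae_of_all _ fun x => ?_
      have h1 : 1 ≤ θ ^ 2 := by
        rw [Real.norm_eq_abs] at hθ; rw [← sq_abs]; nlinarith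
      rw [norm_div, norm_pow, Complex.norm_real, Real.norm_eq_abs, sq_abs,
        div_le_iff₀ (by positivity)]
      refine (norm_levyKernel_le θ x).trans ?_
      have : 0 ≤ min 1 (x ^ 2) := by positivity
      nlinarith
    · refine squeeze_zero_norm (fun θ => ?_) (tendsto_const_add_mul_div_sq_cobounded 2 1)
      rw [norm_div, norm_pow, Complex.norm_real, Real.norm_eq_abs, sq_abs]
      refine div_le_div_of_nonneg_right ?_ (sq_nonneg _)
      simpa using norm_levyKernel_le_linear θ x
  simpa [integral_div] using key

/-! ### The exponent of a pure jump law: behaviour at zero and at infinity -/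

/-- Properties of the characteristic exponent of a centered, square integrable, infinitely
divisible law with variance `v` and without Gaussian component. -/
structure IsPureJumpExponent (ψ : ℝ → ℂ) (v : ℝ) : Prop where
  continuous : Continuous ψ
  quadratic_bound : ∃ C : ℝ, 0 ≤ C ∧ ∀ θ, ‖ψ θ‖ ≤ C * θ ^ 2
  tendsto_zero : Tendsto (fun θ : ℝ => ψ θ / (θ : ℂ) ^ 2) (𝓝[≠] 0) (𝓝 ((v / 2 : ℝ) : ℂ))
  tendsto_cobounded : Tendsto (fun θ : ℝ => ψ θ / (θ : ℂ) ^ 2) (Bornology.cobounded ℝ) (𝓝 0)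

lemma IsPureJumpExponent.map_zero {ψ : ℝ → ℂ} {v : ℝ} (h : IsPureJumpExponent ψ v) : ψ 0 = 0 := by
  obtain ⟨C, -, hC⟩ := h.quadratic_bound
  simpa using hC 0

/-- An exponent inherits the second order expansion of the characteristic function. -/
lemma isLittleO_exponent_sub {φ ψ : ℝ → ℂ} {v : ℝ} (hψ : Continuous ψ) (h0 : ψ 0 = 0)
    (he : ∀ θ, φ θ = Complex.exp (-ψ θ))
    (hφ : (fun θ : ℝ => φ θ - (1 - ((v : ℝ) : ℂ) * (θ : ℂ) ^ 2 / 2)) =o[𝓝 0] fun θ : ℝ => θ ^ 2) :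
    (fun θ : ℝ => ψ θ - ((v / 2 : ℝ) : ℂ) * (θ : ℂ) ^ 2) =o[𝓝 0] fun θ : ℝ => θ ^ 2 := by
  have hψ0 : Tendsto (fun θ => -ψ θ) (𝓝 0) (𝓝 0) := by
    simpa [h0] using! hψ.neg.tendsto 0
  have h1 : (fun z : ℂ => Complex.exp z - 1 - z) =o[𝓝 0] fun z : ℂ => z := by
    have := (Complex.hasDerivAt_exp 0).isLittleO
    simpa using this
  have h2 : (fun θ => φ θ - 1 + ψ θ) =o[𝓝 0] fun θ => ψ θ := by
    have := h1.comp_tendsto hψ0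
    refine (Asymptotics.isLittleO_neg_right.1 this).congr' ?_ EventuallyEq.rfl
    exact Eventually.of_forall fun θ => by simp [he]
  have h3 : (fun θ => φ θ - 1) =O[𝓝 0] fun θ : ℝ => θ ^ 2 := by
    have h4 : (fun θ : ℝ => -(((v : ℝ) : ℂ) * (θ : ℂ) ^ 2 / 2)) =O[𝓝 0] fun θ : ℝ => θ ^ 2 := by
      refine Asymptotics.IsBigO.of_bound (|v| / 2) (Eventually.of_forall fun θ => ?_)
      simp [norm_neg]; linarith
    refine (hφ.isBigO.add h4).congr_left fun θ => by ring
  -- Since `φ - 1 + ψ = o(ψ)`, the exponent is controlled by `φ - 1 = O(θ²)`; the error `o(ψ)` is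
  -- therefore `o(θ²)`.
  have h5 : (fun θ => ψ θ) =O[𝓝 0] fun θ : ℝ => θ ^ 2 := by
    have h6 : (fun θ => ψ θ) =O[𝓝 0] fun θ => φ θ - 1 := by
      refine Asymptotics.isBigO_neg_right.1 (h2.right_isBigO_sub.congr_right fun θ => ?_)
      ring
    exact h6.trans h3
  refine ((h2.trans_isBigO h5).sub hφ).congr_left fun θ => ?_
  push_cast; ring

/-- Three regimes: the hypothesis at `0`, the limit at infinity, and compactness on the annulus `ε ≤
|θ| ≤ R`, where `θ²` is bounded below by `ε²`. -/
lemma exists_quadratic_bound {ψ : ℝ → ℂ} (hψ : Continuous ψ)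
    (h0 : ψ =O[𝓝 0] fun θ : ℝ => θ ^ 2)
    (h1 : Tendsto (fun θ : ℝ => ψ θ / (θ : ℂ) ^ 2) (Bornology.cobounded ℝ) (𝓝 0)) :
    ∃ C : ℝ, 0 ≤ C ∧ ∀ θ, ‖ψ θ‖ ≤ C * θ ^ 2 := by
  obtain ⟨c, hc⟩ := h0.bound
  obtain ⟨ε, hε, hcε⟩ := Metric.eventually_nhds_iff_ball.1 hc
  have h2 : ∀ᶠ θ : ℝ in Bornology.cobounded ℝ, ‖ψ θ / (θ : ℂ) ^ 2‖ ≤ 1 := by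
    have := h1.norm.eventually_le_const (u := 1) (by simp)
    exact this
  obtain ⟨R, -, hR⟩ := (hasBasis_cobounded_norm (E := ℝ)).eventually_iff.1 h2
  obtain ⟨M, hM⟩ := (isCompact_closedBall (0 : ℝ) R).exists_bound_of_continuousOn hψ.continuousOn
  refine ⟨max (max c (M / ε ^ 2)) 1, by positivity, fun θ => ?_⟩
  by_cases hθ : |θ| < ε
  · have := hcε θ (by simpa using hθ)
    refine this.trans ?_
    rw [norm_pow, Real.norm_eq_abs, sq_abs]
    gcongr
    exact (le_max_left _ _).trans (le_max_left _ _)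
  have hθ0 : 0 < θ ^ 2 := by rw [← sq_abs]; have := hε.trans_le (not_lt.1 hθ); positivity
  by_cases hθR : |θ| ≤ R
  · have h3 := hM θ (by simpa using hθR)
    have h4 : M ≤ M / ε ^ 2 * θ ^ 2 := by
      have hM0 : 0 ≤ M := (norm_nonneg _).trans h3
      rw [div_mul_eq_mul_div, le_div_iff₀ (by positivity), ← sq_abs θ]
      exact mul_le_mul_of_nonneg_left (by gcongr; exact not_lt.1 hθ) hM0
    refine (h3.trans h4).trans ?_
    gcongr
    exact (le_max_right _ _).trans (le_max_left _ _)
  · have h3 := hR (x := θ) (by simpa using (not_le.1 hθR).le)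
    rw [norm_div, norm_pow, Complex.norm_real, Real.norm_eq_abs, sq_abs, div_le_iff₀ hθ0] at h3
    refine h3.trans ?_
    gcongr
    exact le_max_right _ _

/-- The Lévy–Khintchine formula supplies a continuous logarithm of the characteristic function and
its subquadratic growth at infinity. The limit at `0` comes instead from the moments, through the
second order Taylor expansion of the characteristic function, so the second moment of the Lévy
measure is never computed. -/
theorem exists_isPureJumpExponent {ν : Measure ℝ} [IsProbabilityMeasure ν]
    (hν : HasNoGaussianComponent ν) (h2 : MemLp id 2 ν) (h1 : ∫ x, x ∂ν = 0) :
    ∃ ψ : ℝ → ℂ, IsPureJumpExponent ψ (∫ x, x ^ 2 ∂ν) ∧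
      ∀ θ, charFun ν θ = Complex.exp (-ψ θ) := by
  obtain ⟨b, μ, hμ, hφ⟩ := hν
  set ψ : ℝ → ℂ := fun θ => -(Complex.I * ((b * θ : ℝ) : ℂ) + ∫ x, levyKernel θ x ∂μ) with hψ
  have he : ∀ θ, charFun ν θ = Complex.exp (-ψ θ) := by
    intro θ
    rw [charFun_apply_real, hψ, neg_neg]
    have := hφ θ
    simp only [NNReal.coe_zero, zero_mul, zero_div, Complex.ofReal_zero, sub_zero] at this
    simp only [levyKernel]
    convert this using 4 with x
    push_cast; ring
  have hc : Continuous ψ := by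
    have := hμ.continuous_integral_levyKernel
    fun_prop
  have h0 : ψ 0 = 0 := by simp [hψ, levyKernel]
  have hT : (fun θ : ℝ => charFun ν θ - (1 - ((∫ x, x ^ 2 ∂ν : ℝ) : ℂ) * (θ : ℂ) ^ 2 / 2))
      =o[𝓝 0] fun θ : ℝ => θ ^ 2 := by
    have h := taylorWithinEval_charFun_two_zero (P := ν) (X := id) aemeasurable_id
      (by rwa [Measure.map_id])
    have h' := taylor_isLittleO_univ (f := charFun ν) (x₀ := 0) (n := 2) (contDiff_charFun h2)
    simp only [sub_zero] at h'
    refine h'.congr_left fun θ => ?_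
    have := h θ
    rw [Measure.map_id] at this
    rw [this]
    simp [h1]
  have hO := isLittleO_exponent_sub hc h0 he hT
  have hinf : Tendsto (fun θ : ℝ => ψ θ / (θ : ℂ) ^ 2) (Bornology.cobounded ℝ) (𝓝 0) := by
    have h3 : Tendsto (fun θ : ℝ => Complex.I * ((b * θ : ℝ) : ℂ) / (θ : ℂ) ^ 2)
        (Bornology.cobounded ℝ) (𝓝 0) := by
      refine squeeze_zero_norm (fun θ => ?_) (tendsto_const_add_mul_div_sq_cobounded 0 |b|)
      rw [norm_div, norm_pow, norm_mul, Complex.norm_I, Complex.norm_real, Complex.norm_real,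
        Real.norm_eq_abs, Real.norm_eq_abs, sq_abs, abs_mul]
      simp
    have := (h3.add hμ.tendsto_integral_levyKernel_div_sq).neg
    simp only [add_zero, neg_zero] at this
    refine this.congr fun θ => ?_
    rw [hψ]; ring
  refine ⟨ψ, ⟨hc, exists_quadratic_bound hc ?_ hinf, ?_, hinf⟩, he⟩
  · have h4 : (fun θ : ℝ => (((∫ x, x ^ 2 ∂ν) / 2 : ℝ) : ℂ) * (θ : ℂ) ^ 2) =O[𝓝 0]
        fun θ : ℝ => θ ^ 2 := by
      refine Asymptotics.IsBigO.of_bound ‖(((∫ x, x ^ 2 ∂ν) / 2 : ℝ) : ℂ)‖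
        (Eventually.of_forall fun θ => ?_)
      rw [norm_mul, norm_pow, norm_pow, Complex.norm_real θ]
    refine (hO.isBigO.add h4).congr_left fun θ => by ring
  · have h5 := hO.mono (nhdsWithin_le_nhds (s := {0}ᶜ))
    have h6 : Tendsto (fun θ : ℝ => (ψ θ - (((∫ x, x ^ 2 ∂ν) / 2 : ℝ) : ℂ) * (θ : ℂ) ^ 2)
        / (θ : ℂ) ^ 2) (𝓝[≠] 0) (𝓝 0) := by
      have h7 : (fun θ : ℝ => ψ θ - (((∫ x, x ^ 2 ∂ν) / 2 : ℝ) : ℂ) * (θ : ℂ) ^ 2) =o[𝓝[≠] 0]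
          fun θ : ℝ => (θ : ℂ) ^ 2 :=
        h5.trans_isBigO (Asymptotics.IsBigO.of_bound 1 (Eventually.of_forall fun θ => by simp))
      exact h7.tendsto_div_nhds_zero
    have h8 := h6.add_const ((((∫ x, x ^ 2 ∂ν) / 2 : ℝ) : ℂ))
    rw [zero_add] at h8
    refine h8.congr' ?_
    filter_upwards [self_mem_nhdsWithin] with θ hθ
    have : (θ : ℂ) ≠ 0 := by exact_mod_cast hθ
    field_simp
    ring

/-! ### One-dimensional laws of a Lévy process -/

lemma tendsto_charFun_of_tendstoInMeasure {Ω ι : Type*} [MeasurableSpace Ω] {P : Measure Ω}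
    [IsProbabilityMeasure P] {l : Filter ι} [l.IsCountablyGenerated] {X : ι → Ω → ℝ} {Z : Ω → ℝ}
    (h : TendstoInMeasure P X l Z) (hX : ∀ i, AEMeasurable (X i) P) (hZ : AEMeasurable Z P)
    (θ : ℝ) :
    Tendsto (fun i => charFun (P.map (X i)) θ) l (𝓝 (charFun (P.map Z) θ)) := by
  have h1 := (h.tendstoInDistribution_of_aemeasurable hX hZ).tendsto
  have h2 := (ProbabilityMeasure.tendsto_iff_forall_integral_rclike_tendsto ℂ).1 h1
  simp_rw [charFun_eq_integral_innerProbChar]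
  exact h2 (BoundedContinuousFunction.innerProbChar θ)

/-- A continuous map from a connected space into the finite, hence discrete, set of `n`-th roots of
unity is constant. This selects the branch when extracting an `n`-th root of a characteristic
function. -/
lemma eq_one_of_pow_eq_one_of_continuous {X : Type*} [TopologicalSpace X] [PreconnectedSpace X]
    {g : X → ℂ} (hg : Continuous g) {n : ℕ} (hn : 0 < n) (hpow : ∀ x, g x ^ n = 1) {x₀ : X}
    (h0 : g x₀ = 1) (x : X) : g x = 1 := by
  set T : Set ℂ := {z | z ^ n = 1} with hT
  have hfin : T.Finite := by
    refine (Polynomial.nthRoots n (1 : ℂ)).toFinset.finite_toSet.subset fun z hz => ?_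
    have : z ^ n = 1 := hz
    simpa [Polynomial.mem_nthRoots hn] using this
  have := isPreconnected_univ.constant_of_mapsTo hfin.isDiscrete hg.continuousOn (fun x _ => hpow x)
    (Set.mem_univ x) (Set.mem_univ x₀)
  rw [this, h0]

/-- A Lévy process almost surely has no jump at a fixed time. -/
lemma IsLevyProcess.leftLim_ae_eq {Ω : Type*} [MeasurableSpace Ω] {P : Measure Ω}
    {L : ℝ≥0 → Ω → ℝ} (hL : IsLevyProcess P L) (t : ℝ≥0) :
    ∀ᵐ ω ∂P, Function.leftLim (fun s => L s ω) t = L t ω := by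
  -- At `t = 0` there is nothing to the left, and `Function.leftLim` is then the value itself.
  rcases eq_or_neBot (𝓝[<] t) with h | h
  · exact ae_of_all _ fun ω => leftLim_eq_of_eq_bot _ h
  -- Stochastic continuity gives almost sure convergence to `L t` along some sequence increasing to
  -- `t` from the left side; its limit must agree with the càdlàg left limit.
  obtain ⟨s, hs, hs'⟩ :=
    ((hL.stochCont t).mono (nhdsWithin_le_nhds (s := Set.Iio t))).exists_seq_tendsto_ae'
  filter_upwards [hs', hL.cadlag] with ω hω hω'
  obtain ⟨l, hl⟩ := (hω' t).2
  rw [leftLim_eq_of_tendsto hl]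
  exact tendsto_nhds_unique (hl.comp hs) hω

namespace IsLevyProcess

variable {Ω : Type*} [MeasurableSpace Ω] {P : Measure Ω} [IsProbabilityMeasure P]
  {L : ℝ≥0 → Ω → ℝ}

lemma charFun_zero_time (hL : IsLevyProcess P L) (θ : ℝ) : charFun (P.map (L 0)) θ = 1 := by
  rw [Measure.map_congr (hL.zero : L 0 =ᵐ[P] fun _ => 0), Measure.map_const]
  simp

lemma charFun_add_time (hL : IsLevyProcess P L) (s h : ℝ≥0) (θ : ℝ) :
    charFun (P.map (L (s + h))) θ = charFun (P.map (L s)) θ * charFun (P.map (L h)) θ := by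
  have hi : IndepFun (L s) (L (s + h) - L s) P :=
    hL.indep.indepFun_eval_sub (zero_le (a := s)) le_self_add hL.zero
  have h1 := hi.charFun_map_add_eq_mul (hL.measurable s).aemeasurable
    ((hL.measurable _).sub (hL.measurable s)).aemeasurable
  rw [add_sub_cancel] at h1
  rw [h1, Pi.mul_apply]
  congr 2
  exact (hL.stationary s h).map_eq

lemma charFun_nat_mul_time (hL : IsLevyProcess P L) (n : ℕ) (h : ℝ≥0) (θ : ℝ) :
    charFun (P.map (L (n * h))) θ = charFun (P.map (L h)) θ ^ n := by
  induction n with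
  | zero => simpa using hL.charFun_zero_time θ
  | succ n ih => rw [Nat.cast_succ, add_mul, one_mul, hL.charFun_add_time, ih, pow_succ]

/-- The `n`-th power of the left side is known, which determines it up to an `n`-th root of unity.
That root depends continuously on `θ` and is `1` at `θ = 0`. -/
lemma charFun_inv_nat_time (hL : IsLevyProcess P L) {ψ : ℝ → ℂ} (hψ : Continuous ψ) (h0 : ψ 0 = 0)
    (h1 : ∀ θ, charFun (P.map (L 1)) θ = Complex.exp (-ψ θ)) {n : ℕ} (hn : 0 < n) (θ : ℝ) :
    charFun (P.map (L (n : ℝ≥0)⁻¹)) θ = Complex.exp (-(ψ θ / n)) := by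
  have : IsProbabilityMeasure (P.map (L (n : ℝ≥0)⁻¹)) :=
    Measure.isProbabilityMeasure_map (hL.measurable _).aemeasurable
  have hn' : (n : ℂ) ≠ 0 := by exact_mod_cast hn.ne'
  have hg := eq_one_of_pow_eq_one_of_continuous
    (g := fun θ => charFun (P.map (L (n : ℝ≥0)⁻¹)) θ * Complex.exp (ψ θ / n)) (x₀ := 0)
    (by fun_prop) hn (fun θ => ?_) (by simp [h0]) θ
  · rw [Complex.exp_neg]
    exact eq_inv_of_mul_eq_one_left hg
  · have hn2 : (n : ℝ≥0) ≠ 0 := by exact_mod_cast hn.ne'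
    rw [mul_pow, ← hL.charFun_nat_mul_time, mul_inv_cancel₀ hn2, h1, ← Complex.exp_nat_mul,
      mul_div_cancel₀ _ hn', ← Complex.exp_add, neg_add_cancel, Complex.exp_zero]

/-- The identity holds at nonnegative rational times by additivity and root extraction; both sides
are continuous in `t`, the left one by stochastic continuity. -/
theorem charFun_eq_exp (hL : IsLevyProcess P L) {ψ : ℝ → ℂ} (hψ : Continuous ψ) (h0 : ψ 0 = 0)
    (h1 : ∀ θ, charFun (P.map (L 1)) θ = Complex.exp (-ψ θ)) (t : ℝ≥0) (θ : ℝ) :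
    charFun (P.map (L t)) θ = Complex.exp (-((t : ℝ) * ψ θ)) := by
  have hc1 : Continuous fun t => charFun (P.map (L t)) θ := continuous_iff_continuousAt.2 fun t =>
    tendsto_charFun_of_tendstoInMeasure (hL.stochCont t) (fun i => (hL.measurable i).aemeasurable)
      (hL.measurable t).aemeasurable θ
  have hc2 : Continuous fun t : ℝ≥0 => Complex.exp (-((t : ℝ) * ψ θ)) := by fun_prop
  -- The shift `q.2 + 1` keeps denominators nonzero.
  have hd : Dense (Set.range fun q : ℕ × ℕ => (q.1 : ℝ≥0) * ((q.2 + 1 : ℕ) : ℝ≥0)⁻¹) := by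
    refine dense_of_exists_between fun a b hab => ?_
    obtain ⟨q, hq1, hq2⟩ := exists_rat_btwn (show (a : ℝ) < b from hab)
    have hq : 0 ≤ q := by
      have : (0 : ℝ) ≤ q := a.2.trans hq1.le
      exact_mod_cast this
    have e : (((q.num.toNat : ℝ≥0) * ((q.den - 1 + 1 : ℕ) : ℝ≥0)⁻¹ : ℝ≥0) : ℝ) = q := by
      have h3 : q.den - 1 + 1 = q.den := Nat.sub_add_cancel q.pos
      have h4 : ((q.num.toNat : ℤ)) = q.num := Int.toNat_of_nonneg (Rat.num_nonneg.2 hq)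
      have h5 : (q.num.toNat : ℝ) = (q.num : ℝ) := by exact_mod_cast h4
      rw [h3]
      push_cast
      rw [h5, ← div_eq_mul_inv]
      exact_mod_cast Rat.num_div_den q
    refine ⟨_, ⟨(q.num.toNat, q.den - 1), rfl⟩, ?_, ?_⟩
    · rw [← NNReal.coe_lt_coe, e]; exact hq1
    · rw [← NNReal.coe_lt_coe, e]; exact hq2
  refine congr_fun (hc1.ext_on hd hc2 ?_) t
  rintro _ ⟨⟨m, n⟩, rfl⟩
  simp only
  rw [hL.charFun_nat_mul_time, hL.charFun_inv_nat_time hψ h0 h1 n.succ_pos, ← Complex.exp_nat_mul]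
  congr 1
  push_cast
  ring

end IsLevyProcess

/-! ### Step functions and elementary integrals on the half-line -/

/-- The increments of a function over finitely many intervals can be expressed through its
increments over the cells of a common partition. -/
lemma exists_common_partition {T : Type*} [LinearOrder T] [Inhabited T] {n : ℕ} (c : Fin n → ℝ)
    (a b : Fin n → T) (hab : ∀ i, a i ≤ b i) :
    ∃ (N : ℕ) (p : ℕ → T) (d : ℕ → ℝ), Monotone p ∧ ∀ F : T → ℝ,
      ∑ i, c i * (F (b i) - F (a i)) = ∑ k ∈ Finset.range N, d k * (F (p (k + 1)) - F (p k)) := by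
  classical
  -- Inserting `default` makes the set of endpoints nonempty even when `n = 0`.
  set s : Finset T := insert default (Finset.univ.image a ∪ Finset.univ.image b) with hs
  obtain ⟨M, hM⟩ : ∃ M, s.card = M + 1 := ⟨s.card - 1,
    (Nat.sub_add_cancel (Finset.card_pos.2 ⟨default, Finset.mem_insert_self _ _⟩)).symm⟩
  set e := s.orderEmbOfFin hM with he
  -- Truncating at `M` makes the partition constant past its last point, hence monotone on all of
  -- `ℕ`.
  set p : ℕ → T := fun k => e ⟨min k M, by omega⟩ with hp
  have hmono : Monotone p := fun i j hij => by
    simp only [hp, OrderEmbedding.le_iff_le, Fin.mk_le_mk]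
    omega
  have hidx : ∀ x ∈ s, ∃ i : ℕ, i ≤ M ∧ p i = x := by
    intro x hx
    have : x ∈ Set.range e := by rw [he, Finset.range_orderEmbOfFin]; exact hx
    obtain ⟨i, rfl⟩ := this
    refine ⟨i, by omega, ?_⟩
    simp only [hp]
    congr 1
    ext
    simp only
    omega
  have hlt : ∀ i j, i ≤ M → j ≤ M → p i ≤ p j → i ≤ j := by
    intro i j hi hj hij
    simp only [hp, OrderEmbedding.le_iff_le, Fin.mk_le_mk] at hij
    omega
  choose! idx hidxM hidxp using hidx
  have ha : ∀ i, a i ∈ s := fun i => by simp [hs]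
  have hb : ∀ i, b i ∈ s := fun i => by simp [hs]
  have hle : ∀ i, idx (a i) ≤ idx (b i) := fun i => by
    refine hlt _ _ (hidxM _ (ha i)) (hidxM _ (hb i)) ?_
    rw [hidxp _ (ha i), hidxp _ (hb i)]
    exact hab i
  -- The weight of a cell is the sum of the `c i` over the intervals that contain it.
  refine ⟨M, p, fun k => ∑ i, if idx (a i) ≤ k ∧ k < idx (b i) then c i else 0, hmono,
    fun F => ?_⟩
  simp_rw [Finset.sum_mul]
  rw [Finset.sum_comm]
  refine Finset.sum_congr rfl fun i _ => ?_
  have h1 : F (b i) - F (a i)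
      = ∑ k ∈ Finset.Ico (idx (a i)) (idx (b i)), (F (p (k + 1)) - F (p k)) := by
    rw [Finset.sum_Ico_sub (fun k => F (p k)) (hle i), hidxp _ (ha i), hidxp _ (hb i)]
  rw [h1, Finset.mul_sum]
  simp_rw [ite_mul, zero_mul]
  rw [← Finset.sum_filter]
  refine Finset.sum_congr ?_ fun _ _ => rfl
  ext k
  have := hidxM _ (hb i)
  simp only [Finset.mem_Ico, Finset.mem_filter, Finset.mem_range]
  omega

/-- Composition of a function vanishing at `0` with a step function on disjoint cells. -/
lemma comp_sum_indicator_cells {T : Type*} [LinearOrder T] {p : ℕ → T} (hp : Monotone p) {N : ℕ}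
    (d : ℕ → ℝ) {ψ : ℝ → ℂ} (h0 : ψ 0 = 0) (u : T) :
    ψ (∑ k ∈ Finset.range N, (Set.Ioc (p k) (p (k + 1))).indicator (fun _ => d k) u)
      = ∑ k ∈ Finset.range N, (Set.Ioc (p k) (p (k + 1))).indicator (fun _ => ψ (d k)) u := by
  by_cases h : ∃ k ∈ Finset.range N, u ∈ Set.Ioc (p k) (p (k + 1))
  · obtain ⟨k, hk, hu⟩ := h
    have hne : ∀ j, j ≠ k → u ∉ Set.Ioc (p j) (p (j + 1)) := fun j hj hu' =>
      Set.disjoint_left.1 (hp.pairwise_disjoint_on_Ioc_succ hj) hu' hu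
    rw [Finset.sum_eq_single_of_mem k hk fun j _ hj => Set.indicator_of_notMem (hne j hj) _,
      Finset.sum_eq_single_of_mem k hk fun j _ hj => Set.indicator_of_notMem (hne j hj) _,
      Set.indicator_of_mem hu, Set.indicator_of_mem hu]
  · push Not at h
    rw [Finset.sum_eq_zero fun k hk => Set.indicator_of_notMem (h k hk) _,
      Finset.sum_eq_zero fun k hk => Set.indicator_of_notMem (h k hk) _, h0]

/-- The indicator is an increment of `t ↦ 1_{u ≤ t}`, so the same partition identity rewrites both
the step function and its elementary integral. -/
lemma indicator_Ioc_eq_mul_sub {T : Type*} [LinearOrder T] {a b : T} (hab : a ≤ b) (c : ℝ) (u : T) :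
    (Set.Ioc a b).indicator (fun _ => c) u
      = c * ((if u ≤ b then 1 else 0) - (if u ≤ a then 1 else 0)) := by
  simp only [Set.indicator_apply, Set.mem_Ioc]
  have : u ≤ a → u ≤ b := fun h => h.trans hab
  by_cases h1 : u ≤ a
  · simp [h1, this h1]
  · by_cases h2 : u ≤ b <;> simp [h1, h2, not_le.1 h1]

/-- The integral of a step function with respect to a (one-sided) Lévy process. -/
theorem IsLevyProcess.charFun_step {Ω : Type*} [MeasurableSpace Ω] {P : Measure Ω}
    [IsProbabilityMeasure P] {L : ℝ≥0 → Ω → ℝ} (hL : IsLevyProcess P L) {ψ : ℝ → ℂ}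
    (hψ : Continuous ψ) (h0 : ψ 0 = 0)
    (h1 : ∀ θ, charFun (P.map (L 1)) θ = Complex.exp (-ψ θ)) {n : ℕ} (c : Fin n → ℝ)
    (a b : Fin n → ℝ≥0) (hab : ∀ i, a i ≤ b i) :
    charFun (P.map fun ω => ∑ i, c i * (L (b i) ω - L (a i) ω)) 1
      = Complex.exp (-∫ u, ψ (∑ i, (Set.Ioc (a i : ℝ) (b i)).indicator (fun _ => c i) u)) := by
  obtain ⟨N, p, d, hp, hF⟩ := exists_common_partition c a b hab
  have hp' : Monotone fun k => (p k : ℝ) := fun i j hij => NNReal.coe_le_coe.2 (hp hij)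
  have hl : (fun ω => ∑ i, c i * (L (b i) ω - L (a i) ω))
      = fun ω => ∑ k ∈ Finset.range N, d k * (L (p (k + 1)) ω - L (p k) ω) :=
    funext fun ω => hF fun t => L t ω
  have hr : ∀ u : ℝ, ψ (∑ i, (Set.Ioc (a i : ℝ) (b i)).indicator (fun _ => c i) u)
      = ∑ k ∈ Finset.range N,
        (Set.Ioc (p k : ℝ) (p (k + 1))).indicator (fun _ => ψ (d k)) u := by
    intro u
    rw [← comp_sum_indicator_cells hp' d h0 u]
    congr 1
    have := hF fun t => if u ≤ t then 1 else 0
    simp_rw [indicator_Ioc_eq_mul_sub (NNReal.coe_le_coe.2 (hab _)),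
      indicator_Ioc_eq_mul_sub (hp' (Nat.le_succ _))]
    exact this
  have hind : iIndepFun (fun k ω => d k * (L (p (k + 1)) ω - L (p k) ω)) P :=
    (hL.indep.nat hp).comp (fun k x => d k * x) fun k => measurable_const_mul _
  have hm : ∀ k, Measurable fun ω => L (p (k + 1)) ω - L (p k) ω := fun k =>
    (hL.measurable _).sub (hL.measurable _)
  rw [hl, iIndepFun.charFun_map_fun_finsetSum_eq_prod
    (fun k _ => ((hm k).const_mul _).aemeasurable) (hind.restrict _),
    Finset.prod_apply]
  simp_rw [hr]
  rw [integral_finsetSum, ← Finset.sum_neg_distrib, Complex.exp_sum]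
  · refine Finset.prod_congr rfl fun k _ => ?_
    rw [charFun_map_mul_comp (hm k).aemeasurable, mul_one, integral_indicator_const _ measurableSet_Ioc]
    have h2 := (hL.stationary (p k) (p (k + 1) - p k)).map_eq
    rw [add_tsub_cancel_of_le (hp (Nat.le_succ k))] at h2
    rw [h2, hL.charFun_eq_exp hψ h0 h1, NNReal.coe_sub (hp (Nat.le_succ k)),
      Real.volume_real_Ioc_of_le (hp' (Nat.le_succ k)), Complex.real_smul]
  · exact fun k _ => (integrable_indicator_iff measurableSet_Ioc).2 (by simp)

/-! ### Continuity of `g ↦ ∫ ψ (g u) du` on `L²` -/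

namespace IsPureJumpExponent

variable {ψ : ℝ → ℂ} {v : ℝ}

lemma integrable_comp {α : Type*} [MeasurableSpace α] {μ : Measure α} (hψ : IsPureJumpExponent ψ v)
    {g : α → ℝ} (hg : MemLp g 2 μ) : Integrable (fun u => ψ (g u)) μ := by
  obtain ⟨C, -, hC⟩ := hψ.quadratic_bound
  refine (hg.integrable_sq.const_mul C).mono'
    (hψ.continuous.comp_aestronglyMeasurable hg.aestronglyMeasurable) (ae_of_all _ fun u => hC _)

/-- The functions `ψ (h n)` need not have a common integrable bound. The difference `‖ψ (h n) - ψ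
g‖` is split into its truncation at `3 C g²`, handled by dominated convergence, and an excess of at
most `2 C (h n - g)²`, whose integral tends to `0` by `L²` convergence. -/
lemma tendsto_integral_comp_of_ae {α : Type*} [MeasurableSpace α] {μ : Measure α}
    (hψ : IsPureJumpExponent ψ v) {h : ℕ → α → ℝ} {g : α → ℝ} (hh : ∀ n, MemLp (h n) 2 μ)
    (hg : MemLp g 2 μ) (hlim : Tendsto (fun n => eLpNorm (fun u => h n u - g u) 2 μ) atTop (𝓝 0))
    (hae : ∀ᵐ u ∂μ, Tendsto (fun n => h n u) atTop (𝓝 (g u))) :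
    Tendsto (fun n => ∫ u, ψ (h n u) ∂μ) atTop (𝓝 (∫ u, ψ (g u) ∂μ)) := by
  obtain ⟨C, hC0, hC⟩ := hψ.quadratic_bound
  have hd : ∀ n, MemLp (fun u => h n u - g u) 2 μ := fun n => (hh n).sub hg
  have hsq : Tendsto (fun n => ∫ u, (h n u - g u) ^ 2 ∂μ) atTop (𝓝 0) := by
    have h1 : ∀ n, ∫ u, (h n u - g u) ^ 2 ∂μ = (eLpNorm (fun u => h n u - g u) 2 μ).toReal ^ 2 := by
      intro n
      rw [(hd n).eLpNorm_eq_integral_rpow_norm (by simp) (by simp), ENNReal.toReal_ofReal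
        (by positivity), ← Real.rpow_natCast, ← Real.rpow_mul (by positivity)]
      simp
    simp_rw [h1]
    have := ((ENNReal.tendsto_toReal ENNReal.zero_ne_top).comp hlim).pow 2
    simpa using! this
  set D : ℕ → α → ℝ := fun n u => ‖ψ (h n u) - ψ (g u)‖ with hD
  have hDint : ∀ n, Integrable (D n) μ := fun n =>
    ((hψ.integrable_comp (hh n)).sub (hψ.integrable_comp hg)).norm
  have hgint : Integrable (fun u => 3 * C * g u ^ 2) μ := hg.integrable_sq.const_mul _
  have hbound : ∀ n u, D n u ≤ min (D n u) (3 * C * g u ^ 2) + 2 * C * (h n u - g u) ^ 2 := by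
    intro n u
    have h1 : D n u ≤ 3 * C * g u ^ 2 + 2 * C * (h n u - g u) ^ 2 := by
      refine (norm_sub_le _ _).trans ((add_le_add (hC _) (hC _)).trans ?_)
      -- The gap in `h² + g² ≤ 3 g² + 2 (h - g)²` is exactly `(h - 2 g)²`.
      nlinarith [mul_nonneg hC0 (sq_nonneg (h n u - 2 * g u))]
    have h2 : 0 ≤ 2 * C * (h n u - g u) ^ 2 := by positivity
    rcases min_cases (D n u) (3 * C * g u ^ 2) with ⟨h3, -⟩ | ⟨h3, -⟩ <;> rw [h3] <;> linarith
  have hmin : Tendsto (fun n => ∫ u, min (D n u) (3 * C * g u ^ 2) ∂μ) atTop (𝓝 0) := by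
    have : Tendsto (fun n => ∫ u, min (D n u) (3 * C * g u ^ 2) ∂μ) atTop (𝓝 (∫ _, (0 : ℝ) ∂μ)) := by
      refine tendsto_integral_of_dominated_convergence (fun u => 3 * C * g u ^ 2)
        (fun n => ((hDint n).inf hgint).aestronglyMeasurable) hgint (fun n => ae_of_all _ fun u => ?_) ?_
      · rw [Real.norm_of_nonneg (le_min (norm_nonneg _) (by positivity))]
        exact min_le_right _ _
      · filter_upwards [hae] with u hu
        have h1 : Tendsto (fun n => D n u) atTop (𝓝 0) := by
          have := (((hψ.continuous.tendsto (g u)).comp hu).sub_const (ψ (g u))).norm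
          simpa using! this
        exact squeeze_zero (fun n => le_min (norm_nonneg _) (by positivity))
          (fun n => min_le_left _ _) h1
    simpa using this
  rw [tendsto_iff_norm_sub_tendsto_zero]
  refine squeeze_zero (fun _ => norm_nonneg _) (fun n => ?_)
    (by simpa using hmin.add (hsq.const_mul (2 * C)))
  have hi1 : Integrable (fun u => min (D n u) (3 * C * g u ^ 2)) μ := (hDint n).inf hgint
  have hi2 : Integrable (fun u => 2 * C * (h n u - g u) ^ 2) μ := (hd n).integrable_sq.const_mul _
  rw [← integral_sub (hψ.integrable_comp (hh n)) (hψ.integrable_comp hg), ← integral_const_mul,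
    ← integral_add hi1 hi2]
  exact (norm_integral_le_integral_norm _).trans
    (integral_mono (hDint n) (hi1.add hi2) (hbound n))

/-- The functional `g ↦ ∫ ψ (g u) du` is continuous on `L²`. -/
theorem tendsto_integral_comp {α : Type*} [MeasurableSpace α] {μ : Measure α}
    (hψ : IsPureJumpExponent ψ v) {h : ℕ → α → ℝ} {g : α → ℝ} (hh : ∀ n, MemLp (h n) 2 μ)
    (hg : MemLp g 2 μ)
    (hlim : Tendsto (fun n => eLpNorm (fun u => h n u - g u) 2 μ) atTop (𝓝 0)) :
    Tendsto (fun n => ∫ u, ψ (h n u) ∂μ) atTop (𝓝 (∫ u, ψ (g u) ∂μ)) := by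
  -- Convergence in `L²` yields almost everywhere convergence only along subsequences, which
  -- suffices because the limit is always the same.
  refine tendsto_of_subseq_tendsto fun ns hns => ?_
  have hm : TendstoInMeasure μ h atTop g := tendstoInMeasure_of_tendsto_eLpNorm two_ne_zero
    (fun n => (hh n).aestronglyMeasurable) hg.aestronglyMeasurable hlim
  obtain ⟨ms, hms, hae⟩ := (hm.comp hns).exists_seq_tendsto_ae
  exact ⟨ms, hψ.tendsto_integral_comp_of_ae (fun n => hh _) hg
    (hlim.comp (hns.comp hms.tendsto_atTop)) hae⟩

end IsPureJumpExponent

/-! ### Elementary integrals of the two-sided process -/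

lemma memLp_sum_indicator_Ioc {n : ℕ} (c a b : Fin n → ℝ) :
    MemLp (fun u => ∑ i, (Set.Ioc (a i) (b i)).indicator (fun _ => c i) u) 2 volume :=
  memLp_finsetSum _ fun i _ =>
    memLp_indicator_const 2 measurableSet_Ioc (c i) (Or.inr (by simp))

lemma StepFun.memLp (h : StepFun) : MemLp h.toFun 2 volume := memLp_sum_indicator_Ioc h.c h.a h.b

section TwoSided

variable {Ω : Type*} [MeasurableSpace Ω] {P : Measure Ω}

/-- At each time one of the two terms is the value at `0`, hence almost surely zero, and left limits
at a fixed time can be dropped. The single formula avoids case distinctions on the signs of interval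
endpoints. -/
lemma twoSided_ae_eq {L₁ L₂ : ℝ≥0 → Ω → ℝ} (h₁ : IsLevyProcess P L₁) (h₂ : IsLevyProcess P L₂)
    (t : ℝ) :
    twoSided L₁ L₂ t =ᵐ[P] fun ω => L₁ t.toNNReal ω - L₂ (-t).toNNReal ω := by
  filter_upwards [h₁.zero, h₂.zero, h₂.leftLim_ae_eq (-t).toNNReal] with ω h10 h20 hl
  unfold twoSided
  split_ifs with ht
  · rw [Real.toNNReal_of_nonpos (by linarith : -t ≤ 0), h20, sub_zero]
  · rw [hl, Real.toNNReal_of_nonpos (by linarith : t ≤ 0), h10, zero_sub]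

lemma IsTwoSidedLevyProcess.aemeasurable {L : ℝ → Ω → ℝ} (hL : IsTwoSidedLevyProcess P L) (t : ℝ) :
    AEMeasurable (L t) P := by
  obtain ⟨L₁, L₂, h₁, h₂, -, -, rfl⟩ := hL
  exact (((h₁.measurable _).sub (h₂.measurable _)).aemeasurable).congr (twoSided_ae_eq h₁ h₂ t).symm

lemma StepFun.aemeasurable_integral {L : ℝ → Ω → ℝ} (hL : IsTwoSidedLevyProcess P L)
    (h : StepFun) : AEMeasurable (h.integral L) P :=
  Finset.aemeasurable_fun_sum _ fun _ _ =>
    ((hL.aemeasurable _).sub (hL.aemeasurable _)).const_mul _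

/-- A step function splits into its parts on the positive and on the negative half-line. -/
lemma comp_sum_indicator_ae_eq {ψ : ℝ → ℂ} (h0 : ψ 0 = 0) {n : ℕ} (c a b : Fin n → ℝ) :
    (fun u => ψ (∑ i, (Set.Ioc (a i) (b i)).indicator (fun _ => c i) u)) =ᵐ[volume] fun u =>
      ψ (∑ i, (Set.Ioc ((a i).toNNReal : ℝ) (b i).toNNReal).indicator (fun _ => c i) u)
      + ψ (∑ i, (Set.Ioc ((-b i).toNNReal : ℝ) (-a i).toNNReal).indicator (fun _ => c i) (-u)) := by
  -- Reflection exchanges the open and closed ends of an interval, and cutting at `0` may lose the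
  -- origin; the two sides can differ only at these finitely many points.
  have hae : ∀ᵐ u : ℝ, u ≠ 0 ∧ ∀ i, u ≠ a i ∧ u ≠ b i := by
    have h1 : ∀ x : ℝ, ∀ᵐ u : ℝ, u ≠ x := fun x => by simp [ae_iff]
    filter_upwards [h1 0, ae_all_iff.2 fun i => h1 (a i), ae_all_iff.2 fun i => h1 (b i)]
      with u h2 h3 h4 using ⟨h2, fun i => ⟨h3 i, h4 i⟩⟩
  filter_upwards [hae] with u ⟨hu0, hu⟩
  rcases lt_or_gt_of_ne hu0 with hneg | hpos
  · have e1 : ∑ i, (Set.Ioc ((a i).toNNReal : ℝ) (b i).toNNReal).indicator (fun _ => c i) u = 0 :=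
      Finset.sum_eq_zero fun i _ => Set.indicator_of_notMem (fun h => by
        have := h.1; have h2 := (a i).toNNReal.2; linarith) _
    rw [e1, h0, zero_add]
    congr 1
    refine Finset.sum_congr rfl fun i _ => ?_
    simp only [Set.indicator_apply, Set.mem_Ioc, Real.coe_toNNReal', max_lt_iff, le_max_iff]
    have h3 := (hu i).1
    have h4 := (hu i).2
    refine if_congr ⟨fun h => ⟨⟨?_, by linarith⟩, Or.inl (by linarith)⟩,
      fun h => ⟨?_, by linarith [h.1.1]⟩⟩ rfl rfl
    · have := lt_of_le_of_ne h.2 h4; linarith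
    · rcases h.2 with h5 | h5
      · exact lt_of_le_of_ne (by linarith) (Ne.symm h3)
      · linarith
  · have e1 : ∑ i, (Set.Ioc ((-b i).toNNReal : ℝ) (-a i).toNNReal).indicator (fun _ => c i) (-u)
        = 0 :=
      Finset.sum_eq_zero fun i _ => Set.indicator_of_notMem (fun h => by
        have := h.1; have h2 := (-b i).toNNReal.2; linarith) _
    rw [e1, h0, add_zero]
    congr 1
    refine Finset.sum_congr rfl fun i _ => ?_
    simp only [Set.indicator_apply, Set.mem_Ioc, Real.coe_toNNReal', max_lt_iff, le_max_iff]
    refine if_congr ⟨fun h => ⟨⟨h.1, hpos⟩, Or.inl h.2⟩, fun h => ⟨h.1.1, ?_⟩⟩ rfl rfl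
    rcases h.2 with h5 | h5
    · exact h5
    · linarith

/-- The characteristic function of an elementary integral. -/
theorem IsTwoSidedLevyProcess.charFun_integral [IsProbabilityMeasure P] {L : ℝ → Ω → ℝ}
    (hL : IsTwoSidedLevyProcess P L) {ψ : ℝ → ℂ} {v : ℝ} (hψ : IsPureJumpExponent ψ v)
    (h1 : ∀ θ, charFun (P.map (L 1)) θ = Complex.exp (-ψ θ)) (h : StepFun) :
    charFun (P.map (h.integral L)) 1 = Complex.exp (-∫ u, ψ (h.toFun u)) := by
  obtain ⟨L₁, L₂, h₁, h₂, hid, hind, rfl⟩ := hL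
  have e1 : ∀ θ, charFun (P.map (L₁ 1)) θ = Complex.exp (-ψ θ) := by
    have : twoSided L₁ L₂ 1 = L₁ 1 := by
      funext ω
      simp [twoSided]
    rwa [this] at h1
  have e2 : ∀ θ, charFun (P.map (L₂ 1)) θ = Complex.exp (-ψ θ) := by
    have h3 : P.map (L₁ 1) = P.map (L₂ 1) := (hid.comp (measurable_pi_apply 1)).map_eq
    rwa [h3] at e1
  set X : Ω → ℝ := fun ω => ∑ i, h.c i * (L₁ (h.b i).toNNReal ω - L₁ (h.a i).toNNReal ω) with hX
  set Y : Ω → ℝ := fun ω => ∑ i, h.c i * (L₂ (-h.a i).toNNReal ω - L₂ (-h.b i).toNNReal ω) with hY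
  have hsplit : h.integral (twoSided L₁ L₂) =ᵐ[P] fun ω => X ω + Y ω := by
    filter_upwards [ae_all_iff.2 fun i => twoSided_ae_eq h₁ h₂ (h.a i),
      ae_all_iff.2 fun i => twoSided_ae_eq h₁ h₂ (h.b i)] with ω ha hb
    simp only [StepFun.integral, hX, hY, ← Finset.sum_add_distrib]
    refine Finset.sum_congr rfl fun i _ => ?_
    rw [ha i, hb i]
    ring
  have hXm : Measurable X :=
    Finset.measurable_fun_sum _ fun i _ => ((h₁.measurable _).sub (h₁.measurable _)).const_mul _
  have hYm : Measurable Y :=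
    Finset.measurable_fun_sum _ fun i _ => ((h₂.measurable _).sub (h₂.measurable _)).const_mul _
  have hXY : IndepFun X Y P := by
    have := hind.comp
      (φ := fun x : ℝ≥0 → ℝ => ∑ i, h.c i * (x (h.b i).toNNReal - x (h.a i).toNNReal))
      (ψ := fun x : ℝ≥0 → ℝ => ∑ i, h.c i * (x (-h.a i).toNNReal - x (-h.b i).toNNReal))
      (by fun_prop) (by fun_prop)
    exact this
  rw [Measure.map_congr hsplit, hXY.charFun_map_fun_add_eq_mul hXm.aemeasurable hYm.aemeasurable,
    Pi.mul_apply,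
    h₁.charFun_step hψ.continuous hψ.map_zero e1 h.c _ _ fun i => Real.toNNReal_le_toNNReal (h.le i),
    h₂.charFun_step hψ.continuous hψ.map_zero e2 h.c _ _ fun i =>
      Real.toNNReal_le_toNNReal (neg_le_neg (h.le i)), ← Complex.exp_add]
  congr 1
  have hi2 := hψ.integrable_comp (memLp_sum_indicator_Ioc h.c
    (fun i => ((-h.b i).toNNReal : ℝ)) fun i => ((-h.a i).toNNReal : ℝ))
  simp only [StepFun.toFun]
  rw [integral_congr_ae (comp_sum_indicator_ae_eq hψ.map_zero h.c h.a h.b),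
    integral_add (hψ.integrable_comp (memLp_sum_indicator_Ioc h.c
      (fun i => ((h.a i).toNNReal : ℝ)) fun i => ((h.b i).toNNReal : ℝ))) hi2.comp_neg,
    integral_neg_eq_self fun u => ψ (∑ i, (Set.Ioc ((-h.b i).toNNReal : ℝ)
      (-h.a i).toNNReal).indicator (fun _ => h.c i) u)]
  ring

end TwoSided

/-! ### Characteristic functions on `Fin k → ℝ` -/

/-- The characteristic function of a measure on `ℝ^k`. -/
noncomputable def piCharFun {k : ℕ} (ν : Measure (Fin k → ℝ)) (θ : Fin k → ℝ) : ℂ :=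
  ∫ x, Complex.exp (Complex.I * ((∑ j, θ j * x j : ℝ) : ℂ)) ∂ν

/-- The linear functional `x ↦ ∑ j, θ j * x j`. -/
noncomputable def dotDual {k : ℕ} (θ : Fin k → ℝ) : StrongDual ℝ (Fin k → ℝ) :=
  ∑ j, θ j • ContinuousLinearMap.proj (R := ℝ) (φ := fun _ : Fin k => ℝ) j

lemma dotDual_apply {k : ℕ} (θ x : Fin k → ℝ) : dotDual θ x = ∑ j, θ j * x j := by
  simp [dotDual]

lemma dotDual_surjective {k : ℕ} : Function.Surjective (dotDual (k := k)) := by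
  intro l
  refine ⟨fun j => l (Pi.single j 1), ?_⟩
  ext x
  rw [dotDual_apply]
  conv_rhs => rw [← Finset.univ_sum_single x, map_sum]
  refine Finset.sum_congr rfl fun j _ => ?_
  have : Pi.single j (x j) = x j • (Pi.single j (1 : ℝ) : Fin k → ℝ) := by
    rw [← Pi.single_smul, smul_eq_mul, mul_one]
  rw [this, map_smul, smul_eq_mul, mul_comm]

lemma piCharFun_eq_charFunDual {k : ℕ} (ν : Measure (Fin k → ℝ)) (θ : Fin k → ℝ) :
    piCharFun ν θ = charFunDual ν (dotDual θ) := by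
  simp_rw [charFunDual_apply, piCharFun, dotDual_apply, mul_comm Complex.I]

lemma piCharFun_map {Ω : Type*} [MeasurableSpace Ω] {P : Measure Ω} {k : ℕ} {V : Ω → Fin k → ℝ}
    (hV : AEMeasurable V P) (θ : Fin k → ℝ) :
    piCharFun (P.map V) θ = charFun (P.map fun ω => ∑ j, θ j * V ω j) 1 := by
  rw [piCharFun_eq_charFunDual, charFunDual_eq_charFun_map_one,
    AEMeasurable.map_map_of_aemeasurable (by fun_prop) hV]
  simp only [Function.comp_def, dotDual_apply]

lemma measure_ext_of_piCharFun {k : ℕ} {ν ν' : Measure (Fin k → ℝ)} [IsFiniteMeasure ν]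
    [IsFiniteMeasure ν'] (h : ∀ θ, piCharFun ν θ = piCharFun ν' θ) : ν = ν' := by
  refine Measure.ext_of_charFunDual (funext fun l => ?_)
  obtain ⟨θ, rfl⟩ := dotDual_surjective l
  simpa only [piCharFun_eq_charFunDual] using h θ

lemma piCharFun_map_sum_pi {k n : ℕ} (ρ : Measure (Fin k → ℝ)) [IsProbabilityMeasure ρ]
    (θ : Fin k → ℝ) :
    piCharFun ((Measure.pi fun _ : Fin n => ρ).map fun x => ∑ i, x i) θ = piCharFun ρ θ ^ n := by
  rw [piCharFun_eq_charFunDual, charFunDual_map_sum_pi_eq_prod, Finset.prod_const, Finset.card_univ,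
    Fintype.card_fin, Pi.pow_apply, piCharFun_eq_charFunDual]

lemma isInfinitelyDivisible_of_piCharFun_pow {k : ℕ} {ν : Measure (Fin k → ℝ)}
    [IsProbabilityMeasure ν]
    (h : ∀ n : ℕ, 0 < n → ∃ ρ : Measure (Fin k → ℝ), IsProbabilityMeasure ρ ∧
      ∀ θ, piCharFun ν θ = piCharFun ρ θ ^ n) : IsInfinitelyDivisible ν := by
  intro n hn
  obtain ⟨ρ, hρ, he⟩ := h n hn
  refine ⟨ρ, hρ, ?_⟩
  have : IsProbabilityMeasure ((Measure.pi fun _ : Fin n => ρ).map fun x => ∑ i, x i) :=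
    Measure.isProbabilityMeasure_map (by fun_prop)
  exact measure_ext_of_piCharFun fun θ => by rw [he, piCharFun_map_sum_pi]

/-- **Lévy's continuity theorem**, existence part. -/
theorem exists_charFun_eq_of_tendsto {E : Type*} [NormedAddCommGroup E] [InnerProductSpace ℝ E]
    [FiniteDimensional ℝ E] [MeasurableSpace E] [BorelSpace E] {μ : ℕ → Measure E}
    [∀ n, IsProbabilityMeasure (μ n)] {f : E → ℂ} (hf : ContinuousAt f 0)
    (h : ∀ t, Tendsto (fun n => charFun (μ n) t) atTop (𝓝 (f t))) :
    ∃ ρ : Measure E, IsProbabilityMeasure ρ ∧ charFun ρ = f := by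
  let μ' : ℕ → ProbabilityMeasure E := fun n => ⟨μ n, inferInstance⟩
  have ht := isTightMeasureSet_of_tendsto_charFun hf h
  have hc : IsCompact (closure (Set.range μ')) := by
    refine isCompact_closure_of_isTightMeasureSet ?_
    refine ht.subset ?_
    rintro _ ⟨_, ⟨n, rfl⟩, rfl⟩
    exact ⟨n, rfl⟩
  -- Tightness gives compactness of the closure; an ultrafilter finer than `atTop` then produces a
  -- limit law without extracting a subsequence.
  let U : Ultrafilter ℕ := Ultrafilter.of atTop
  obtain ⟨ρ, -, hρ : Tendsto _ _ _⟩ := hc.ultrafilter_le_nhds (U.map μ')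
    (le_trans (by simp) (monotone_principal subset_closure))
  refine ⟨ρ, inferInstance, funext fun t => ?_⟩
  have h1 := (ProbabilityMeasure.tendsto_iff_forall_integral_rclike_tendsto ℂ).1 hρ
    (BoundedContinuousFunction.innerProbChar t)
  have h2 : Tendsto (fun n => charFun (μ n) t) U (𝓝 (f t)) := (h t).mono_left (Ultrafilter.of_le _)
  rw [charFun_eq_integral_innerProbChar]
  refine tendsto_nhds_unique h1 ?_
  simpa only [charFun_eq_integral_innerProbChar] using! h2

/-- Transport through `EuclideanSpace`, since `Fin k → ℝ` carries the sup norm and no inner product.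
-/
theorem exists_piCharFun_eq_of_tendsto {k : ℕ} {μ : ℕ → Measure (Fin k → ℝ)}
    [∀ n, IsProbabilityMeasure (μ n)] {f : (Fin k → ℝ) → ℂ} (hf : Continuous f)
    (h : ∀ t, Tendsto (fun n => piCharFun (μ n) t) atTop (𝓝 (f t))) :
    ∃ ρ : Measure (Fin k → ℝ), IsProbabilityMeasure ρ ∧ ∀ θ, piCharFun ρ θ = f θ := by
  have key : ∀ (ν : Measure (EuclideanSpace ℝ (Fin k))) (θ : EuclideanSpace ℝ (Fin k)),
      piCharFun (ν.map (WithLp.ofLp (p := 2))) (WithLp.ofLp θ) = charFun ν θ := by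
    intro ν θ
    rw [piCharFun, charFun_apply, integral_map (by fun_prop)
      (by apply Continuous.aestronglyMeasurable; fun_prop)]
    simp [PiLp.inner_apply, mul_comm]
  have hm : ∀ n, IsProbabilityMeasure ((μ n).map (WithLp.toLp 2)) := fun n =>
    Measure.isProbabilityMeasure_map (by fun_prop)
  obtain ⟨ρ, hρ, he⟩ := exists_charFun_eq_of_tendsto
    (μ := fun n => (μ n).map (WithLp.toLp 2)) (f := fun θ => f (WithLp.ofLp θ))
    (hf.comp (by fun_prop)).continuousAt fun θ => by
      simp_rw [← key]
      have e : ∀ n, ((μ n).map (WithLp.toLp 2)).map (WithLp.ofLp (p := 2)) = μ n := fun n => by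
        rw [Measure.map_map (by fun_prop) (by fun_prop)]
        exact Measure.map_id
      simp_rw [e]
      exact h _
  refine ⟨ρ.map (WithLp.ofLp (p := 2)), Measure.isProbabilityMeasure_map (by fun_prop), fun θ => ?_⟩
  have := key ρ (WithLp.toLp 2 θ)
  rw [he] at this
  exact this

/-! ### Linear combinations of step functions -/

/-- The step function `u ↦ h (m * u)`. -/
noncomputable def StepFun.dilate (h : StepFun) {m : ℝ} (hm : 0 < m) : StepFun where
  n := h.n
  c := h.c
  a i := h.a i / m
  b i := h.b i / m
  le i := div_le_div_of_nonneg_right (h.le i) hm.le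

lemma StepFun.dilate_toFun (h : StepFun) {m : ℝ} (hm : 0 < m) (u : ℝ) :
    (h.dilate hm).toFun u = h.toFun (m * u) := by
  simp only [StepFun.toFun, StepFun.dilate, Set.indicator_apply, Set.mem_Ioc, div_lt_iff₀ hm,
    le_div_iff₀ hm, mul_comm m u]
  rfl

lemma StepFun.exists_linear_combination {ι : Type*} {Ω : Type*} (L : ℝ → Ω → ℝ)
    (s : Finset ι) (θ : ι → ℝ) (h : ι → StepFun) :
    ∃ H : StepFun, (∀ u, H.toFun u = ∑ j ∈ s, θ j * (h j).toFun u) ∧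
      ∀ ω, H.integral L ω = ∑ j ∈ s, θ j * (h j).integral L ω := by
  classical
  induction s using Finset.induction_on with
  | empty =>
    exact ⟨⟨0, Fin.elim0, Fin.elim0, Fin.elim0, fun i => i.elim0⟩, fun u => by simp [StepFun.toFun],
      fun ω => by simp [StepFun.integral]⟩
  | insert j s hj ih =>
    obtain ⟨H, h1, h2⟩ := ih
    refine ⟨⟨(h j).n + H.n, Fin.append (fun i => θ j * (h j).c i) H.c, Fin.append (h j).a H.a,
      Fin.append (h j).b H.b, Fin.addCases (fun i => by simpa using (h j).le i)
        (fun i => by simpa using H.le i)⟩, fun u => ?_, fun ω => ?_⟩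
    · rw [Finset.sum_insert hj, ← h1]
      simp only [StepFun.toFun, Fin.sum_univ_add, Fin.append_left, Fin.append_right, Finset.mul_sum,
        Set.indicator_apply, mul_ite, mul_zero]
    · rw [Finset.sum_insert hj, ← h2]
      simp only [StepFun.integral, Fin.sum_univ_add, Fin.append_left, Fin.append_right,
        Finset.mul_sum, mul_assoc]

lemma tendsto_eLpNorm_linear_combination {α : Type*} [MeasurableSpace α] {μ : Measure α} {k : ℕ}
    (θ : Fin k → ℝ) {X : Fin k → ℕ → α → ℝ} {Y : Fin k → α → ℝ}
    (hX : ∀ j n, AEStronglyMeasurable (X j n) μ) (hY : ∀ j, AEStronglyMeasurable (Y j) μ)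
    (h : ∀ j, Tendsto (fun n => eLpNorm (fun u => X j n u - Y j u) 2 μ) atTop (𝓝 0)) :
    Tendsto (fun n => eLpNorm (fun u => ∑ j, θ j * X j n u - ∑ j, θ j * Y j u) 2 μ) atTop (𝓝 0) := by
  have h1 : Tendsto (fun n => ∑ j, ‖θ j‖ₑ * eLpNorm (fun u => X j n u - Y j u) 2 μ) atTop (𝓝 0) := by
    rw [show (0 : ℝ≥0∞) = ∑ j : Fin k, ‖θ j‖ₑ * 0 by simp]
    exact tendsto_finsetSum _ fun j _ => ENNReal.Tendsto.const_mul (h j) (Or.inr (by simp))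
  refine tendsto_of_tendsto_of_tendsto_of_le_of_le tendsto_const_nhds h1 (fun _ => zero_le) fun n => ?_
  have e : (fun u => ∑ j, θ j * X j n u - ∑ j, θ j * Y j u)
      = ∑ j, θ j • fun u => X j n u - Y j u := by
    funext u
    simp [Finset.sum_apply, mul_sub]
  simp only [e]
  refine (eLpNorm_sum_le (fun j _ => ((hX j n).sub (hY j)).const_smul _) one_le_two).trans ?_
  exact Finset.sum_le_sum fun j _ => (eLpNorm_const_smul _ _ _ _).le

/-! ### Joint laws of Lévy integrals -/

section LevyIntegral

variable {Ω : Type*} [MeasurableSpace Ω] {P : Measure Ω} [IsProbabilityMeasure P] {L : ℝ → Ω → ℝ}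
  {ψ : ℝ → ℂ} {v : ℝ} {k : ℕ} {g : Fin k → ℝ → ℝ} {Y : Fin k → Ω → ℝ}

lemma IsPureJumpExponent.continuous_integral_comp_sum (hψ : IsPureJumpExponent ψ v)
    (hg : ∀ j, MemLp (g j) 2 volume) :
    Continuous fun θ : Fin k → ℝ => ∫ u, ψ (∑ j, θ j * g j u) := by
  have hmem : ∀ θ : Fin k → ℝ, MemLp (fun u => ∑ j, θ j * g j u) 2 volume := fun θ =>
    memLp_finsetSum _ fun j _ => (hg j).const_mul (θ j)
  refine continuous_iff_seqContinuous.2 fun θ θ₀ hθ => ?_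
  refine hψ.tendsto_integral_comp (fun n => hmem _) (hmem _) ?_
  have hsum : Tendsto (fun n => ∑ j, ‖θ n j - θ₀ j‖ₑ * eLpNorm (g j) 2 volume) atTop (𝓝 0) := by
    rw [show (0 : ℝ≥0∞) = ∑ j : Fin k, 0 * eLpNorm (g j) 2 volume by simp]
    refine tendsto_finsetSum _ fun j _ => ENNReal.Tendsto.mul_const ?_ (Or.inr (hg j).2.ne)
    have := (((continuous_apply j).tendsto θ₀).comp hθ).sub_const (θ₀ j)
    simpa using! this.enorm
  refine tendsto_of_tendsto_of_tendsto_of_le_of_le tendsto_const_nhds hsum (fun _ => zero_le)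
    fun n => ?_
  have e : (fun u => ∑ j, θ n j * g j u - ∑ j, θ₀ j * g j u)
      = ∑ j, (θ n j - θ₀ j) • g j := by
    funext u
    simp [Finset.sum_apply, sub_mul]
  simp only [e]
  refine (eLpNorm_sum_le (fun j _ => (hg j).1.const_smul _) one_le_two).trans ?_
  exact Finset.sum_le_sum fun j _ => (eLpNorm_const_smul _ _ _ _).le

/-- The joint characteristic function of Lévy integrals. -/
theorem IsLevyIntegral.piCharFun_map (hL : IsTwoSidedLevyProcess P L) (hψ : IsPureJumpExponent ψ v)
    (h1 : ∀ θ, charFun (P.map (L 1)) θ = Complex.exp (-ψ θ)) (hg : ∀ j, MemLp (g j) 2 volume)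
    (hY : ∀ j, IsLevyIntegral P L (g j) (Y j)) (θ : Fin k → ℝ) :
    piCharFun (P.map fun ω j => Y j ω) θ = Complex.exp (-∫ u, ψ (∑ j, θ j * g j u)) := by
  choose hYL h hhg hhY using hY
  rw [_root_.piCharFun_map (aemeasurable_pi_lambda _ fun j => (hYL j).1.aemeasurable)]
  choose H hHf hHi using fun n => StepFun.exists_linear_combination L Finset.univ θ fun j => h j n
  have t1 : Tendsto (fun n => charFun (P.map ((H n).integral L)) 1) atTop
      (𝓝 (charFun (P.map fun ω => ∑ j, θ j * Y j ω) 1)) := by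
    refine tendsto_charFun_of_tendstoInMeasure ?_ (fun n => (H n).aemeasurable_integral hL)
      (Finset.aemeasurable_fun_sum _ fun j _ => (hYL j).1.aemeasurable.const_mul _) 1
    refine tendstoInMeasure_of_tendsto_eLpNorm two_ne_zero
      (fun n => ((H n).aemeasurable_integral hL).aestronglyMeasurable)
      (Finset.aemeasurable_fun_sum _ fun j _ =>
        (hYL j).1.aemeasurable.const_mul _).aestronglyMeasurable ?_
    refine (tendsto_eLpNorm_linear_combination θ
      (fun j n => ((h j n).aemeasurable_integral hL).aestronglyMeasurable)
      (fun j => (hYL j).1) hhY).congr fun n => ?_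
    congr 1
    funext ω
    simp only [Pi.sub_apply, hHi]
  have t2 : Tendsto (fun n => Complex.exp (-∫ u, ψ ((H n).toFun u))) atTop
      (𝓝 (Complex.exp (-∫ u, ψ (∑ j, θ j * g j u)))) := by
    refine (Complex.continuous_exp.tendsto _).comp (Tendsto.neg ?_)
    refine hψ.tendsto_integral_comp (fun n => (H n).memLp)
      (memLp_finsetSum _ fun j _ => (hg j).const_mul (θ j)) ?_
    refine (tendsto_eLpNorm_linear_combination θ (fun j n => (h j n).memLp.1)
      (fun j => (hg j).1) hhg).congr fun n => ?_
    simp only [hHf]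
  refine tendsto_nhds_unique t1 (t2.congr fun n => ?_)
  rw [hL.charFun_integral hψ h1]

/-- The joint law of Lévy integrals is infinitely divisible. -/
theorem IsLevyIntegral.isInfinitelyDivisible_map (hL : IsTwoSidedLevyProcess P L)
    (hψ : IsPureJumpExponent ψ v) (h1 : ∀ θ, charFun (P.map (L 1)) θ = Complex.exp (-ψ θ))
    (hg : ∀ j, MemLp (g j) 2 volume) (hY : ∀ j, IsLevyIntegral P L (g j) (Y j)) :
    IsInfinitelyDivisible (P.map fun ω j => Y j ω) := by
  have hm : AEMeasurable (fun ω j => Y j ω) P :=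
    aemeasurable_pi_lambda _ fun j => (hY j).1.1.aemeasurable
  have : IsProbabilityMeasure (P.map fun ω j => Y j ω) := Measure.isProbabilityMeasure_map hm
  refine isInfinitelyDivisible_of_piCharFun_pow fun m hm0 => ?_
  have hmpos : (0 : ℝ) < m := by exact_mod_cast hm0
  have hcf := IsLevyIntegral.piCharFun_map hL hψ h1 hg hY
  choose hYL h hhg hhY using hY
  have hVm : ∀ n, AEMeasurable (fun ω j => ((h j n).dilate hmpos).integral L ω) P := fun n =>
    aemeasurable_pi_lambda _ fun j => StepFun.aemeasurable_integral hL _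
  have hprob : ∀ n, IsProbabilityMeasure
      (P.map fun ω j => ((h j n).dilate hmpos).integral L ω) := fun n =>
    Measure.isProbabilityMeasure_map (hVm n)
  -- The substitution `u ↦ m u` has Jacobian `1 / m`, so the dilated elementary integrals have `1 /
  -- m` times the original exponents. Their limit law is the required `m`-th convolution root.
  obtain ⟨ρ, hρ, he⟩ := exists_piCharFun_eq_of_tendsto
    (μ := fun n => P.map fun ω j => ((h j n).dilate hmpos).integral L ω)
    (f := fun θ => Complex.exp (-((m : ℝ)⁻¹ • ∫ u, ψ (∑ j, θ j * g j u))))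
    (Complex.continuous_exp.comp
      ((continuous_const_smul _).comp (hψ.continuous_integral_comp_sum hg)).neg)
    fun θ => by
      choose H hHf hHi using fun n =>
        StepFun.exists_linear_combination L Finset.univ θ fun j => (h j n).dilate hmpos
      have e : ∀ n, piCharFun (P.map fun ω j => ((h j n).dilate hmpos).integral L ω) θ
          = Complex.exp (-((m : ℝ)⁻¹ • ∫ u, ψ (∑ j, θ j * (h j n).toFun u))) := by
        intro n
        rw [_root_.piCharFun_map (hVm n)]
        simp_rw [← hHi n]
        rw [show (fun ω => (H n).integral L ω) = (H n).integral L from rfl,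
          hL.charFun_integral hψ h1]
        simp_rw [hHf, StepFun.dilate_toFun]
        rw [Measure.integral_comp_mul_left (fun u => ψ (∑ j, θ j * (h j n).toFun u)),
          abs_of_pos (inv_pos.2 hmpos)]
      simp_rw [e]
      refine (Complex.continuous_exp.tendsto _).comp (Tendsto.neg (Tendsto.const_smul ?_ _))
      exact hψ.tendsto_integral_comp
        (fun n => memLp_finsetSum _ fun j _ => (h j n).memLp.const_mul (θ j))
        (memLp_finsetSum _ fun j _ => (hg j).const_mul (θ j))
        (tendsto_eLpNorm_linear_combination θ (fun j n => (h j n).memLp.1) (fun j => (hg j).1) hhg)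
  refine ⟨ρ, hρ, fun θ => ?_⟩
  rw [he, hcf, ← Complex.exp_nat_mul, Complex.real_smul]
  congr 1
  have : (m : ℂ) ≠ 0 := by exact_mod_cast hm0.ne'
  push_cast
  field_simp

end LevyIntegral

/-! ### Asymptotics of the marginal exponent and uniqueness of the parameters -/

/-- Write `ψ (θ x) / θ² = x² · ψ (θ x) / (θ x)²` and dominate by `C g²`; points with `g u = 0`
contribute nothing. It serves both ends: `w = v / 2` as `θ → 0` and `w = 0` as `θ → ∞`. -/
lemma IsPureJumpExponent.tendsto_integral_div_sq {ψ : ℝ → ℂ} {v : ℝ} (hψ : IsPureJumpExponent ψ v)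
    {g : ℝ → ℝ} (hg : MemLp g 2 volume) {l : Filter ℝ} [l.IsCountablyGenerated] {w : ℂ}
    (hl : ∀ᶠ θ in l, θ ≠ 0)
    (h : ∀ x : ℝ, x ≠ 0 → Tendsto (fun θ : ℝ => ψ (θ * x) / ((θ * x : ℝ) : ℂ) ^ 2) l (𝓝 w)) :
    Tendsto (fun θ : ℝ => (∫ u, ψ (θ * g u)) / (θ : ℂ) ^ 2) l
      (𝓝 (w * ((∫ u, g u ^ 2 : ℝ) : ℂ))) := by
  obtain ⟨C, hC0, hC⟩ := hψ.quadratic_bound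
  have key : Tendsto (fun θ : ℝ => ∫ u, ψ (θ * g u) / (θ : ℂ) ^ 2) l
      (𝓝 (∫ u, w * ((g u ^ 2 : ℝ) : ℂ))) := by
    refine tendsto_integral_filter_of_dominated_convergence (fun u => C * g u ^ 2)
      (Eventually.of_forall fun θ => ?_) ?_ (hg.integrable_sq.const_mul C) (ae_of_all _ fun u => ?_)
    · exact ((hψ.integrable_comp (hg.const_mul θ)).div_const _).aestronglyMeasurable
    · filter_upwards [hl] with θ hθ
      refine ae_of_all _ fun u => ?_
      rw [norm_div, norm_pow, Complex.norm_real, Real.norm_eq_abs, sq_abs,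
        div_le_iff₀ (by positivity)]
      refine (hC _).trans (le_of_eq ?_)
      ring
    · rcases eq_or_ne (g u) 0 with h0 | h0
      · simpa [h0, hψ.map_zero] using tendsto_const_nhds
      · refine ((h (g u) h0).mul_const ((g u ^ 2 : ℝ) : ℂ)).congr' ?_
        filter_upwards [hl] with θ hθ
        have h1 : (θ : ℂ) ≠ 0 := by exact_mod_cast hθ
        have h2 : (g u : ℂ) ≠ 0 := by exact_mod_cast h0
        push_cast
        field_simp
  rw [integral_const_mul, integral_complex_ofReal] at key
  refine key.congr fun θ => ?_
  rw [integral_div]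

/-- A function with distinct limits of `q r / r ^ 2` at `0` and `∞` has at most one pair of
scaling exponents. -/
lemma scaling_exponents_unique {q : ℝ → ℂ} {c : ℂ} (hc : c ≠ 0)
    (h0 : Tendsto (fun r : ℝ => q r / (r : ℂ) ^ 2) (𝓝[>] 0) (𝓝 c))
    (hinf : Tendsto (fun r : ℝ => q r / (r : ℂ) ^ 2) atTop (𝓝 0)) {α δ α' δ' : ℝ}
    (h : ∀ T : ℝ, 0 < T → ∀ r : ℝ, ((T ^ δ : ℝ) : ℂ) * q (T ^ (α - δ / 2) * r)
      = ((T ^ δ' : ℝ) : ℂ) * q (T ^ (α' - δ' / 2) * r)) : α' = α ∧ δ' = δ := by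
  set Q : ℝ → ℂ := fun r => q r / (r : ℂ) ^ 2 with hQ
  -- Passing from `q` to `Q` turns the prefactor `T^d` into `T^(2a)`, so that near `r = 0` only the
  -- first parameter is visible.
  have hform : ∀ a d T r : ℝ, 0 < T → 0 < r → ((T ^ d : ℝ) : ℂ) * q (T ^ (a - d / 2) * r)
      = ((T ^ (2 * a) * r ^ 2 : ℝ) : ℂ) * Q (T ^ (a - d / 2) * r) := by
    intro a d T r hT hr
    have e1 : T ^ (2 * a) = T ^ d * (T ^ (a - d / 2)) ^ 2 := by
      rw [← Real.rpow_natCast, ← Real.rpow_mul hT.le, ← Real.rpow_add hT]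
      congr 1; push_cast; ring
    have h1 : ((T ^ (a - d / 2) : ℝ) : ℂ) ≠ 0 := by
      exact_mod_cast (Real.rpow_pos_of_pos hT _).ne'
    have h2 : (r : ℂ) ≠ 0 := by exact_mod_cast hr.ne'
    generalize T ^ (a - d / 2) = b at *
    rw [e1, hQ]
    push_cast
    field_simp
  have h' : ∀ T r : ℝ, 0 < T → 0 < r → ((T ^ (2 * α) : ℝ) : ℂ) * Q (T ^ (α - δ / 2) * r)
      = ((T ^ (2 * α') : ℝ) : ℂ) * Q (T ^ (α' - δ' / 2) * r) := by
    intro T r hT hr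
    have h1 := h T hT r
    rw [hform α δ T r hT hr, hform α' δ' T r hT hr] at h1
    have h2 : ((r ^ 2 : ℝ) : ℂ) ≠ 0 := by exact_mod_cast (pow_pos hr 2).ne'
    refine mul_left_cancel₀ h2 ?_
    push_cast at h1 ⊢
    linear_combination h1
  have hscale : ∀ s : ℝ, 0 < s → Tendsto (fun r : ℝ => Q (s * r)) (𝓝[>] 0) (𝓝 c) := by
    intro s hs
    refine h0.comp (tendsto_nhdsWithin_iff.2 ⟨?_, ?_⟩)
    · have : Tendsto (fun r : ℝ => s * r) (𝓝 0) (𝓝 0) := by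
        simpa using (tendsto_id (x := 𝓝 (0 : ℝ))).const_mul s
      exact this.mono_left nhdsWithin_le_nhds
    · filter_upwards [self_mem_nhdsWithin] with r hr using mul_pos hs hr
  have hα : α' = α := by
    -- Letting `r → 0` at `T = 2` gives `2^(2α) c = 2^(2α') c`; any positive `T ≠ 1` would do.
    have t1 := (hscale ((2 : ℝ) ^ (α - δ / 2)) (by positivity)).const_mul (((2 : ℝ) ^ (2 * α) : ℝ) : ℂ)
    have t2 := (hscale ((2 : ℝ) ^ (α' - δ' / 2)) (by positivity)).const_mul
      (((2 : ℝ) ^ (2 * α') : ℝ) : ℂ)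
    have e := tendsto_nhds_unique (t1.congr' (by
      filter_upwards [self_mem_nhdsWithin] with r hr using h' 2 r two_pos hr)) t2
    have e2 : (2 : ℝ) ^ (2 * α) = (2 : ℝ) ^ (2 * α') := by exact_mod_cast mul_right_cancel₀ hc e
    have := (Real.rpow_right_inj two_pos (by norm_num)).1 e2
    linarith
  refine ⟨hα, by_contra fun hδ => hc ?_⟩
  subst hα
  have hconst : ∀ x : ℝ, 0 < x → Q x = Q 1 := by
    intro x hx
    -- Chosen so that `T^((δ' - δ)/2) = x`. With `r = T^(-(α' - δ'/2))` below, the two arguments of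
    -- `Q` become `x` and `1`.
    set T : ℝ := x ^ (2 / (δ' - δ)) with hT
    have hTpos : 0 < T := Real.rpow_pos_of_pos hx _
    have hd : δ' - δ ≠ 0 := sub_ne_zero.2 hδ
    have h1 := h' T (T ^ (-(α' - δ' / 2))) hTpos (by positivity)
    have hTx : T ^ (α' - δ / 2 + -(α' - δ' / 2)) = x := by
      rw [hT, ← Real.rpow_mul hx.le,
        show 2 / (δ' - δ) * (α' - δ / 2 + -(α' - δ' / 2)) = 1 by field_simp; ring, Real.rpow_one]
    rw [← Real.rpow_add hTpos, ← Real.rpow_add hTpos, add_neg_cancel, Real.rpow_zero, hTx] at h1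
    have h2 : ((T ^ (2 * α') : ℝ) : ℂ) ≠ 0 := by
      exact_mod_cast (Real.rpow_pos_of_pos hTpos _).ne'
    exact mul_left_cancel₀ h2 h1
  have l0 : Q 1 = c := tendsto_nhds_unique (tendsto_const_nhds.congr' (by
    filter_upwards [self_mem_nhdsWithin] with r hr using (hconst r hr).symm)) h0
  have l1 : Q 1 = 0 := tendsto_nhds_unique (tendsto_const_nhds.congr' (by
    filter_upwards [eventually_gt_atTop 0] with r hr using (hconst r hr).symm)) hinf
  exact l0.symm.trans l1

/-! ### Generalized fractional Lévy processes -/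

namespace IsGenFracLevyProcess

variable {Ω : Type*} [MeasurableSpace Ω] {P : Measure Ω} [IsProbabilityMeasure P] {L : ℝ → Ω → ℝ}
  {f : ℝ → ℝ → ℝ} {S : ℝ → Ω → ℝ}

lemma exists_exponent (hS : IsGenFracLevyProcess P L f S) :
    ∃ ψ : ℝ → ℂ, IsPureJumpExponent ψ (∫ ω, (L 1 ω) ^ 2 ∂P) ∧
      ∀ θ, charFun (P.map (L 1)) θ = Complex.exp (-ψ θ) := by
  have hm := hS.levy.aemeasurable 1
  have : IsProbabilityMeasure (P.map (L 1)) := Measure.isProbabilityMeasure_map hm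
  have h2 : MemLp id 2 (P.map (L 1)) :=
    (memLp_map_measure_iff aestronglyMeasurable_id hm).2 hS.memLp
  have h1 : ∫ x, x ∂(P.map (L 1)) = 0 := by
    exact (integral_map hm aestronglyMeasurable_id).trans hS.centered
  have hv : ∫ x, x ^ 2 ∂(P.map (L 1)) = ∫ ω, (L 1 ω) ^ 2 ∂P :=
    integral_map hm (by fun_prop)
  rw [← hv]
  exact exists_isPureJumpExponent hS.noGaussian h2 h1

lemma isInfinitelyDivisibleProcess (hS : IsGenFracLevyProcess P L f S) :
    IsInfinitelyDivisibleProcess P S := by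
  obtain ⟨ψ, hψ, h1⟩ := hS.exists_exponent
  exact ⟨fun t => (hS.eq_integral t).1.1.aemeasurable, fun k t =>
    IsLevyIntegral.isInfinitelyDivisible_map hS.levy hψ h1 (fun j => hS.kernel_memLp (t j))
      fun j => hS.eq_integral (t j)⟩

/-- The characteristic exponents of a generalized fractional Lévy process. -/
lemma isCharacteristicExponent (hS : IsGenFracLevyProcess P L f S) {ψ : ℝ → ℂ} {v : ℝ}
    (hψ : IsPureJumpExponent ψ v) (h1 : ∀ θ, charFun (P.map (L 1)) θ = Complex.exp (-ψ θ))
    {k : ℕ} (t : Fin k → ℝ) :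
    IsCharacteristicExponent (fdd P S t) fun θ => ∫ u, ψ (∑ j, θ j * f (t j) u) where
  continuous := hψ.continuous_integral_comp_sum fun j => hS.kernel_memLp (t j)
  map_zero := by simp [hψ.map_zero]
  exp_neg := IsLevyIntegral.piCharFun_map hS.levy hψ h1 (fun j => hS.kernel_memLp (t j))
    fun j => hS.eq_integral (t j)

end IsGenFracLevyProcess

/-- The kernel relation at time `T t_j` extracts `T^(α - δ/2)`, and the substitution `u ↦ u / T^δ`
contributes the Jacobian `T^δ`. -/
lemma integral_comp_sum_scaling {f : ℝ → ℝ → ℝ} {α δ : ℝ}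
    (hf : ∀ t u T : ℝ, 0 < T → f t u = T ^ (α - δ / 2) * f (t / T) (u / T ^ δ)) (ψ : ℝ → ℂ)
    {T : ℝ} (hT : 0 < T) {k : ℕ} (t θ : Fin k → ℝ) :
    ∫ u, ψ (∑ j, θ j * f (T * t j) u)
      = ((T ^ δ : ℝ) : ℂ) * ∫ u, ψ (∑ j, T ^ (α - δ / 2) * θ j * f (t j) u) := by
  have e : ∀ u, ∑ j, θ j * f (T * t j) u
      = ∑ j, T ^ (α - δ / 2) * θ j * f (t j) (u / T ^ δ) := by
    refine fun u => Finset.sum_congr rfl fun j _ => ?_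
    rw [hf (T * t j) u T hT, mul_div_cancel_left₀ _ hT.ne']
    ring
  simp_rw [e]
  rw [Measure.integral_comp_div (fun u => ψ (∑ j, T ^ (α - δ / 2) * θ j * f (t j) u)),
    abs_of_pos (Real.rpow_pos_of_pos hT δ), Complex.real_smul]

theorem proposition2p3 {Ω : Type*} [MeasurableSpace Ω] (P : Measure Ω) [IsProbabilityMeasure P]
    (L : ℝ → Ω → ℝ) (f : ℝ → ℝ → ℝ) (S : ℝ → Ω → ℝ) (hS : IsGenFracLevyProcess P L f S)
    (α δ : ℝ)
    (hf : ∀ t u T : ℝ, 0 < T → f t u = T ^ (α - δ / 2) * f (t / T) (u / T ^ δ)) :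
    IsDilativelyStable P S α δ ∧
      (0 < ∫ ω, (L 1 ω) ^ 2 ∂P → 0 < ∫ u, (f 1 u) ^ 2 →
        ∀ α' δ' : ℝ, IsDilativelyStable P S α' δ' → α' = α ∧ δ' = δ) := by
  obtain ⟨ψ, hψ, h1⟩ := hS.exists_exponent
  have hexp := fun {k : ℕ} (t : Fin k → ℝ) => hS.isCharacteristicExponent hψ h1 t
  refine ⟨⟨hS.isInfinitelyDivisibleProcess, fun t θ => ∫ u, ψ (∑ j, θ j * f (t j) u),
    fun k t => hexp t, fun T hT k t θ => integral_comp_sum_scaling hf ψ hT t θ⟩, ?_⟩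
  rintro hv hf1 α' δ' ⟨-, ψ', hψ', hs'⟩
  have huniq : ∀ {k : ℕ} (t θ : Fin k → ℝ), ψ' t θ = ∫ u, ψ (∑ j, θ j * f (t j) u) :=
    fun t θ => congr_fun ((hψ' _ t).unique (hexp t)) θ
  have hg := hS.kernel_memLp 1
  have h0 : Tendsto (fun r : ℝ => (∫ u, ψ (r * f 1 u)) / (r : ℂ) ^ 2) (𝓝[>] 0)
      (𝓝 ((((∫ ω, (L 1 ω) ^ 2 ∂P) / 2 : ℝ) : ℂ) * ((∫ u, f 1 u ^ 2 : ℝ) : ℂ))) := by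
    have hl : ∀ᶠ θ : ℝ in 𝓝[>] 0, θ ≠ 0 := by
      filter_upwards [self_mem_nhdsWithin] with θ hθ using ne_of_gt hθ
    refine hψ.tendsto_integral_div_sq hg hl fun x hx => ?_
    refine hψ.tendsto_zero.comp (tendsto_nhdsWithin_iff.2 ⟨?_, ?_⟩)
    · have : Tendsto (fun r : ℝ => r * x) (𝓝 0) (𝓝 0) := by
        simpa using (tendsto_id (x := 𝓝 (0 : ℝ))).mul_const x
      exact this.mono_left nhdsWithin_le_nhds
    · filter_upwards [hl] with r hr using mul_ne_zero hr hx
  have hinf : Tendsto (fun r : ℝ => (∫ u, ψ (r * f 1 u)) / (r : ℂ) ^ 2) atTop (𝓝 0) := by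
    have := hψ.tendsto_integral_div_sq hg (w := 0) (eventually_ne_atTop 0) fun x hx =>
      hψ.tendsto_cobounded.comp (tendsto_norm_atTop_iff_cobounded.1 ?_)
    · simpa using this
    · simp_rw [norm_mul]
      exact tendsto_norm_atTop_atTop.atTop_mul_const (norm_pos_iff.2 hx)
  refine scaling_exponents_unique ?_ h0 hinf fun T hT r => ?_
  · exact_mod_cast (mul_pos (half_pos hv) hf1).ne'
  -- The exponent of `S_T` is computed twice from that of `S_1`: by the assumed `(α', δ')` scaling
  -- and by the scaling of the kernel.
  · have e1 := hs' T hT 1 (fun _ => 1) fun _ => r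
    rw [huniq, huniq, integral_comp_sum_scaling hf ψ hT] at e1
    simpa using e1
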